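/- Let $\Omega\subset\mathbb R^N$ ($N\ge 1$) be a bounded open set with smooth ($C^\infty$) boundary, and let $\lambda>0$. Lebesgue spaces on $\partial\Omega$ are taken with respect to the $(N-1)$-dimensional Hausdorff measure $\mathcal H^{N-1}$. For $u\in BV(\Omega)\cap L^2(\Omega)$, let $Du$ be its distributional gradient, $|Du|$ the total variation measure of $Du$, and $u|_{\partial\Omega}\in L^1(\partial\Omega)$ its trace. For $\mathbf z\in L^\infty(\Omega;\mathbb R^N)$ with $\operatorname{div}\mathbf z\in L^2(\Omega)$, let $(\mathbf z,Du)$ be the Radon measure on $\Omega$ given by $$\langle(\mathbf z,Du),\varphi\rangle=-\int_\Omega u\,\varphi\,\operatorname{div}\mathbf z\,dx-\int_\Omega u\,\mathbf z\cdot\nabla\varphi\,dx,\qquad \varphi\in C_c^\infty(\Omega),$$ and let $[\mathbf z,\nu]\in L^\infty(\partial\Omega)$ be the weak trace of the normal component of $\mathbf z$, that is, the function with $$\int_\Omega\varphi\,\operatorname{div}\mathbf z\,dx+\int_\Omega\mathbf z\cdot\nabla\varphi\,dx=\int_{\partial\Omega}[\mathbf z,\nu]\,\varphi\,d\mathcal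 H^{N-1}\qquad\text{for all }\varphi\in C_c^\infty(\mathbb R^N).$$ Let $\operatorname{sign}$ be the multivalued sign: $\operatorname{sign}(s)=\{1\}$ for $s>0$, $\{-1\}$ for $s<0$, and $\operatorname{sign}(0)=[-1,1]$. Define the multivalued operator $\mathcal B$ in $L^2(\partial\Omega)$ as follows: $v\in\mathcal B(\omega)$ if $\omega\in L^2(\partial\Omega)$, $v\in L^\infty(\partial\Omega)$ with $\|v\|_{L^\infty(\partial\Omega)}\le1$, and there exist $u\in BV(\Omega)\cap L^2(\Omega)$ and $\mathbf z\in L^\infty(\Omega;\mathbb R^N)$ with $\|\mathbf z\|_{L^\infty(\Omega)}\le1$ such that (i) $\lambda u-\operatorname{div}\mathbf z=0$ in $\mathcal D'(\Omega)$; (ii) $(\mathbf z,Du)=|Du|$ as measures in $\Omega$; (iii) $[\mathbf z,\nu]=v$ $\mathcal H^{N-1}$-a.e. on $\partial\Omega$; (iv) $[\mathbf z,\nu]\in\operatorname{sign}(\omega-u|_{\partial\Omega})$ $\mathcal H^{N-1}$-a.e. on $\partial\Omega$. **Theorem.** The operator $\mathcal B$ is monotone in $L^2(\partial\Omega)$: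 whenever $v_1\in\mathcal B(\omega_1)$ and $v_2\in\mathcal B(\omega_2)$, $$\int_{\partial\Omega}(v_1-v_2)(\omega_1-\omega_2)\,d\mathcal H^{N-1}\ge0 .$$ Hence $\mathcal B$ is accretive in $L^2(\partial\Omega)$: for all such $\omega_i,v_i$ and all $\alpha\ge0$, $$\|v_1-v_2+\alpha(\omega_1-\omega_2)\|_{L^2(\partial\Omega)}\ge\|v_1-v_2\|_{L^2(\partial\Omega)}\quad\text{and}\quad\|\omega_1-\omega_2+\alpha(v_1-v_2)\|_{L^2(\partial\Omega)}\ge\|\omega_1-\omega_2\|_{L^2(\partial\Omega)} .$$ -/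

import Mathlib

open MeasureTheory Set Filter TopologicalSpace
open scoped Topology Distributions

noncomputable section

/-- The Euclidean space `ℝ^N`. -/
abbrev Euc (N : ℕ) : Type := EuclideanSpace ℝ (Fin N)

/-- The boundary of `Ω` is smooth: near each boundary point, and in suitable orthonormal coordinates
with last axis `e`, the set `Ω` is the strict supergraph of a `C^∞` function `γ` of the remaining
coordinates (that is, of a function `γ` on the whole space which does not depend on the coordinate
along `e`). In particular `Ω` lies locally on one side of its boundary. -/
def HasSmoothBoundary {N : ℕ} (Ω : Opens (Euc N)) : Prop :=
  ∀ x ∈ frontier (Ω : Set (Euc N)), ∃ (e : Euc N) (γ : Euc N → ℝ) (r : ℝ),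
    ‖e‖ = 1 ∧ ContDiff ℝ ((⊤ : ℕ∞) : WithTop ℕ∞) γ ∧
      (∀ (y : Euc N) (t : ℝ), γ (y + t • e) = γ y) ∧ 0 < r ∧
      ∀ y ∈ Metric.ball x r, (y ∈ Ω ↔ γ y < inner ℝ e y)

/-- The surface measure of `∂Ω`: the `(N-1)`-dimensional Hausdorff measure (normalized so that it is
the Euclidean area) restricted to `∂Ω`. -/
def surfaceMeasure {N : ℕ} (Ω : Opens (Euc N)) : Measure (Euc N) :=
  (Measure.euclideanHausdorffMeasure (N - 1) : Measure (Euc N)).restrict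
    (frontier (Ω : Set (Euc N)))

/-- `L²(∂Ω)`. -/
abbrev L2Boundary {N : ℕ} (Ω : Opens (Euc N)) : Type := Lp ℝ 2 (surfaceMeasure Ω)

/-- `u ∈ BV(Ω)` with distributional gradient `Du`: `u ∈ L¹(Ω)`, and `Du` is an `ℝ^N`-valued measure
on `Ω` (extended by zero outside `Ω`) of finite total variation such that
`∫_Ω u ∇φ dx = - ∫_Ω φ dDu` for all `φ ∈ C_c^∞(Ω)`. The total variation measure `|Du|` is
`Du.variation`. -/
structure IsBVWithGradient {N : ℕ} (Ω : Opens (Euc N)) (u : Euc N → ℝ)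
    (Du : VectorMeasure (Euc N) (Euc N)) : Prop where
  integrableOn : IntegrableOn u Ω
  finite_variation : IsFiniteMeasure Du.variation
  variation_compl : Du.variation (Ω : Set (Euc N))ᶜ = 0
  integral_gradient : ∀ φ : 𝓓(Ω, ℝ),
    ∫ x in Ω, u x • gradient φ x = - ∫ᵛ x, φ x ∂•Du

/-- `τ ∈ L¹(∂Ω)` is the trace on `∂Ω` of `u ∈ BV(Ω)`: for `H^{N-1}`-almost every `x ∈ ∂Ω`,
the mean value of `|u - τ(x)|` over `Ω ∩ B(x, r)` tends to `0` as `r → 0+`. -/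
def HasBoundaryTrace {N : ℕ} (Ω : Opens (Euc N)) (u τ : Euc N → ℝ) : Prop :=
  Integrable τ (surfaceMeasure Ω) ∧
    ∀ᵐ x ∂(surfaceMeasure Ω),
      Tendsto (fun r : ℝ => ⨍ y in (Ω : Set (Euc N)) ∩ Metric.ball x r, |u y - τ x|)
        (𝓝[>] 0) (𝓝 0)

/-- `z ∈ L^∞(Ω; ℝ^N)` with `‖z‖_∞ ≤ 1`. -/
def IsUnitBoundedField {N : ℕ} (Ω : Opens (Euc N)) (z : Euc N → Euc N) : Prop :=
  AEStronglyMeasurable z (volume.restrict Ω) ∧ ∀ᵐ x ∂(volume.restrict (Ω : Set (Euc N))), ‖z x‖ ≤ 1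

/-- `div z = d` in the sense of distributions in `Ω`. -/
def HasDistribDiv {N : ℕ} (Ω : Opens (Euc N)) (z : Euc N → Euc N) (d : Euc N → ℝ) : Prop :=
  ∀ φ : 𝓓(Ω, ℝ), ∫ x in Ω, d x * φ x = - ∫ x in Ω, inner ℝ (z x) (gradient φ x)

/-- The functional `⟨(z, Du), φ⟩ = - ∫_Ω u φ div z - ∫_Ω u z · ∇φ`, where `d = div z`. -/
def anzellottiPairing {N : ℕ} (Ω : Opens (Euc N)) (z : Euc N → Euc N) (d u φ : Euc N → ℝ) : ℝ :=
  - (∫ x in Ω, u x * φ x * d x) - ∫ x in Ω, u x * inner ℝ (z x) (gradient φ x)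

/-- `γ ∈ L^∞(∂Ω)` is the weak trace `[z, ν]` on `∂Ω` of the normal component of a field `z` with
`div z = d`: one has `∫_Ω φ div z + ∫_Ω z · ∇φ = ∫_{∂Ω} γ φ dH^{N-1}` for all `φ ∈ C_c^∞(ℝ^N)`. -/
def HasNormalTrace {N : ℕ} (Ω : Opens (Euc N)) (z : Euc N → Euc N) (d γ : Euc N → ℝ) : Prop :=
  MemLp γ ⊤ (surfaceMeasure Ω) ∧
    ∀ φ : 𝓓((⊤ : Opens (Euc N)), ℝ),
      (∫ x in Ω, φ x * d x) + ∫ x in Ω, inner ℝ (z x) (gradient φ x) =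
        ∫ x, γ x * φ x ∂(surfaceMeasure Ω)

/-- The multivalued sign: `{1}` for `s > 0`, `{-1}` for `s < 0`, and `[-1, 1]` for `s = 0`. -/
def multiSign (s : ℝ) : Set ℝ :=
  {t | (0 < s → t = 1) ∧ (s < 0 → t = -1) ∧ (s = 0 → t ∈ Icc (-1 : ℝ) 1)}

/-- The operator `B` in `L²(∂Ω)`: `v ∈ B(ω)` if `‖v‖_∞ ≤ 1` and there are `u ∈ BV(Ω) ∩ L²(Ω)`
(with gradient measure `Du` and boundary trace `τ`) and `z` with `‖z‖_∞ ≤ 1` such that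
`lam u - div z = 0` in `D'(Ω)`, `(z, Du) = |Du|` as measures in `Ω`,
`[z, ν] = v` a.e. on `∂Ω`, and `[z, ν] ∈ sign (ω - u)` a.e. on `∂Ω`. -/
def boundaryOperator {N : ℕ} (lam : ℝ) (Ω : Opens (Euc N)) (ω : L2Boundary Ω) :
    Set (L2Boundary Ω) :=
  {v | (∀ᵐ x ∂(surfaceMeasure Ω), |v x| ≤ 1) ∧
    ∃ (u : Euc N → ℝ) (Du : VectorMeasure (Euc N) (Euc N)) (τ : Euc N → ℝ) (z : Euc N → Euc N),
      IsBVWithGradient Ω u Du ∧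
      MemLp u 2 (volume.restrict Ω) ∧
      HasBoundaryTrace Ω u τ ∧
      IsUnitBoundedField Ω z ∧
      HasDistribDiv Ω z (fun x => lam * u x) ∧
      (∀ φ : 𝓓(Ω, ℝ),
        anzellottiPairing Ω z (fun x => lam * u x) u φ = ∫ x, φ x ∂Du.variation) ∧
      HasNormalTrace Ω z (fun x => lam * u x) v ∧
      ∀ᵐ x ∂(surfaceMeasure Ω), v x ∈ multiSign (ω x - τ x)}

/-- Accretivity of a multivalued operator `A` in a normed space, in the form
`‖v - v' + α (ω - ω')‖ ≥ ‖v - v'‖` for `α ≥ 0`, `v ∈ A ω`, `v' ∈ A ω'`. -/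
def IsAccretive {X : Type*} [NormedAddCommGroup X] [NormedSpace ℝ X] (A : X → Set X) : Prop :=
  ∀ (ω ω' v v' : X), v ∈ A ω → v' ∈ A ω' → ∀ α : ℝ, 0 ≤ α →
    ‖v - v'‖ ≤ ‖v - v' + α • (ω - ω')‖

/-- Accretivity in the resolvent form: `‖ω - ω' + α (v - v')‖ ≥ ‖ω - ω'‖` for `α ≥ 0`, `v ∈ A ω`,
`v' ∈ A ω'`. In Hilbert spaces it is equivalent to `IsAccretive`. -/
def IsResolventAccretive {X : Type*} [NormedAddCommGroup X] [NormedSpace ℝ X]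
    (A : X → Set X) : Prop :=
  ∀ (ω ω' v v' : X), v ∈ A ω → v' ∈ A ω' → ∀ α : ℝ, 0 ≤ α →
    ‖ω - ω'‖ ≤ ‖ω - ω' + α • (v - v')‖

end

/-!
The operator is monotone because of a Green formula for pairs `(z, u)`, where `z` is a bounded field
with `div z = d` in `L²` and normal trace `v`, and `u` is a `BV ∩ L²` function with boundary trace
`τ`. Put `Λ(χ) = -∫_Ω u χ d - ∫_Ω u z · ∇χ + ∫_{∂Ω} v χ τ` for `χ ∈ C_c^∞(ℝ^N)` (`extendedPairing`),
which is the pairing `(z, Du)` when `χ` is supported in `Ω`. The central estimate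
(`IsGreenPair.abs_extendedPairing_le`) is `|Λ(χ)| ≤ ∫ |χ| d|Du|`, with no boundary contribution.
Taking `χ = 1` on the closure of `Ω` gives `∫ v τ - ∫_Ω u d ≤ |Du|(Ω)`. If moreover
`(z, Du) = |Du|`, splitting `χ = φ + (χ - φ)` with a cutoff `φ` supported in `Ω` gives the reverse
inequality. Applying the first to the crossed pairs `(z₁, u₂)`, `(z₂, u₁)` and the second to
`(z₁, u₁)`, `(z₂, u₂)`, with `d = lam * u`, one finds
`∫ (v₁ - v₂) (τ₁ - τ₂) ≥ lam ∫_Ω (u₁ - u₂)² ≥ 0`, and `(v₁ - v₂) ((ω₁ - τ₁) - (ω₂ - τ₂)) ≥ 0`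
pointwise since the sign graph is monotone. Accretivity is then the expansion of a square in the
Hilbert space `L²(∂Ω)`.

The central estimate is local, by a partition of unity. Near a point of the closure of `Ω` there is
an inward direction `e` (`IsConeChart`), and `u` is replaced by its means
`u_t(x) = ∫ u(x + t η) K(η) dη` with a bump function `K` concentrated near `e` (`shiftedMean`): they
are smooth on the whole space and, at points of the closure of `Ω`, only see values of `u` inside
`Ω`. Testing the definition of the normal trace with `χ u_t` and letting `t → 0` gives `Λ(χ)` as the
limit of `∫_Ω χ z · ∇u_t`, which is controlled by `|Du|` because `|∇u_t|` is at most the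
corresponding mean of `|Du|`. The convergence of the boundary term needs `u_t → τ` in `L¹(∂Ω)`
(`IsConeChart.exists_lintegral_sub_trace_le`). Convergence almost everywhere is the definition of
the trace. For the norm, the kernel of `u_t` has `t`-derivative equal to minus the divergence of the
dilation field times the kernel, so `|∂_t u_t(x)|` is at most a multiple of `t^{-N} |Du|(B)` for a
ball `B` of radius comparable to `t`. By Tonelli's theorem and the bound
`H^{N-1}(∂Ω ∩ B(p, t)) ≤ A t^{N-1}`, the family `u_t` is Cauchy in `L¹(∂Ω)`, with error a multiple
of `|Du|` of a thin layer along `∂Ω`.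
-/

section
open scoped ContDiff Convolution Manifold

/-! ### Cone charts of a domain with smooth boundary -/

/-- A neighbourhood `ball x₀ r` in which `Ω` satisfies an interior cone condition along `e`, up to
the height `t₀` and with aperture `2 * c`, and in which the surface measure of `∂Ω` is bounded above
as for an `(N - 1)`-dimensional set. Interior points are included, with `e = 0`. The factor `2`
keeps the balls of radius `c * t` at distance at least `c * t` from the complement of `Ω`. -/
structure IsConeChart {N : ℕ} (Ω : Opens (Euc N)) (x₀ e : Euc N) (c r t₀ A : ℝ) : Prop where
  c_pos : 0 < c
  c_le_one : c ≤ 1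
  norm_le_one : ‖e‖ ≤ 1
  r_pos : 0 < r
  t_pos : 0 < t₀
  closedBall_subset : ∀ x ∈ closure (Ω : Set (Euc N)), x ∈ Metric.ball x₀ r → ∀ t, 0 < t → t < t₀ →
    Metric.closedBall (x + t • e) (2 * c * t) ⊆ Ω
  surfaceMeasure_le : ∀ (p : Euc N) (t : ℝ), 0 < t →
    surfaceMeasure Ω (Metric.ball x₀ r ∩ Metric.closedBall p t) ≤ ENNReal.ofReal (A * t ^ (N - 1))

theorem exists_isConeChart_of_mem {N : ℕ} {Ω : Opens (Euc N)} {x₀ : Euc N} (hx : x₀ ∈ Ω) :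
    ∃ e c r t₀ A, IsConeChart Ω x₀ e c r t₀ A := by
  obtain ⟨ρ, hρ, hρΩ⟩ := Metric.isOpen_iff.1 Ω.isOpen x₀ hx
  refine ⟨0, 1 / 2, ρ / 2, ρ / 2, 0, by norm_num, by norm_num, by simp, by positivity,
    by positivity, ?_, ?_⟩
  · intro x _ hxr t _ ht y hy
    apply hρΩ
    simp only [smul_zero, add_zero, Metric.mem_closedBall, Metric.mem_ball] at *
    linarith [dist_triangle y x x₀]
  · intro p t _
    have : surfaceMeasure Ω (Metric.ball x₀ (ρ / 2) ∩ Metric.closedBall p t) = 0 := by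
      rw [surfaceMeasure, Measure.restrict_apply
        (Metric.isOpen_ball.measurableSet.inter Metric.isClosed_closedBall.measurableSet)]
      refine measure_mono_null (t := ∅) ?_ measure_empty
      rintro y ⟨⟨hy, -⟩, hy2⟩
      rw [Ω.isOpen.frontier_eq] at hy2
      exact (hy2.2 (hρΩ (Metric.ball_subset_ball (by linarith) hy))).elim
    simp [this]

/-- A set that a map to an `(N - 1)`-dimensional subspace embeds with Lipschitz inverse has
`H^{N-1}` measure at most that of the image ball, up to the power of the Lipschitz constant. -/
theorem euclideanHausdorffMeasure_le_of_antilipschitzOn {N : ℕ} {W : Submodule ℝ (Euc N)}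
    (hW : Module.finrank ℝ W = N - 1) (P : Euc N → W) (K : NNReal) {S : Set (Euc N)}
    (hP : ∀ x ∈ S, ∀ y ∈ S, dist x y ≤ K * dist (P x) (P y)) {q : W} {t : ℝ} (ht : 0 ≤ t)
    (hq : ∀ x ∈ S, dist (P x) q ≤ t) :
    (Measure.euclideanHausdorffMeasure (N - 1) : Measure (Euc N)) S ≤
      K ^ (N - 1) * (ENNReal.ofReal (t ^ (N - 1)) *
        (Measure.euclideanHausdorffMeasure (Module.finrank ℝ W) : Measure W)
          (Metric.ball 0 1)) := by
  have hanti : AntilipschitzWith K (fun x : S => P x) :=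
    AntilipschitzWith.of_le_mul_dist fun x y => hP x x.2 y y.2
  have h1 := hanti.le_hausdorffMeasure_image (d := ((N - 1 : ℕ) : ℝ)) (by positivity) univ
  have h2 : (Measure.euclideanHausdorffMeasure (N - 1) : Measure S) univ ≤
      K ^ (N - 1) * (Measure.euclideanHausdorffMeasure (N - 1) : Measure W)
        ((fun x : S => P x) '' univ) := by
    simp only [Measure.euclideanHausdorffMeasure_def, Measure.smul_apply,
      Measure.nnreal_smul_coe_apply]
    rw [ENNReal.rpow_natCast] at h1
    calc _ ≤ _ := mul_le_mul_right h1 _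
      _ = _ := by ring
  have h3 : (Measure.euclideanHausdorffMeasure (N - 1) : Measure (Euc N)) S =
      (Measure.euclideanHausdorffMeasure (N - 1) : Measure S) univ := by
    have hiso : Isometry (fun x : S => (x : Euc N)) := fun _ _ => rfl
    rw [← hiso.euclideanHausdorffMeasure_image]
    simp
  rw [h3]
  refine h2.trans ?_
  gcongr
  have h4 : ((fun x : S => P x) '' univ) ⊆ Metric.closedBall q t := by
    rintro _ ⟨x, -, rfl⟩
    exact hq x x.2
  refine (measure_mono h4).trans ?_
  rw [← hW, Measure.addHaar_closedBall _ _ ht]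

/-- Only the local Lipschitz bound `L` of the graph function is used: it gives the cone condition
with aperture of order `1 / (L + 1)`, and the projection along `e` is injective on the graph, with
inverse of Lipschitz constant `L + 1`. -/
theorem HasSmoothBoundary.exists_isConeChart {N : ℕ} {Ω : Opens (Euc N)}
    (hΩ : HasSmoothBoundary Ω) {x₀ : Euc N} (hx : x₀ ∈ frontier (Ω : Set (Euc N))) :
    ∃ e c r t₀ A, IsConeChart Ω x₀ e c r t₀ A := by
  obtain ⟨e, γ, R, he, hγ, hinv, hR, hmem⟩ := hΩ x₀ hx
  have hγ1 : ContDiff ℝ 1 γ := hγ.of_le (by exact_mod_cast le_top)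
  obtain ⟨L, s, hs, hL⟩ := (hγ1.contDiffAt (x := x₀)).exists_lipschitzOnWith
  obtain ⟨ρ', hρ', hρs⟩ := Metric.mem_nhds_iff.1 hs
  obtain ⟨ρ, hρ, hρR, hρρ⟩ : ∃ ρ, 0 < ρ ∧ ρ ≤ R ∧ ρ ≤ ρ' :=
    ⟨min R ρ', lt_min hR hρ', min_le_left _ _, min_le_right _ _⟩
  have hLip : ∀ x ∈ Metric.ball x₀ ρ, ∀ y ∈ Metric.ball x₀ ρ, |γ x - γ y| ≤ L * ‖x - y‖ := by
    intro x hx y hy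
    have := hL.dist_le_mul x (hρs (Metric.ball_subset_ball hρρ hx)) y
      (hρs (Metric.ball_subset_ball hρρ hy))
    rwa [Real.dist_eq, dist_eq_norm] at this
  have hmem' : ∀ y ∈ Metric.ball x₀ ρ, (y ∈ Ω ↔ γ y < inner ℝ e y) := fun y hy =>
    hmem y (Metric.ball_subset_ball hρR hy)
  have hclos : ∀ y ∈ closure (Ω : Set (Euc N)), y ∈ Metric.ball x₀ ρ → γ y ≤ inner ℝ e y := by
    intro y hy hyb
    by_contra! hlt
    have ho : IsOpen {w : Euc N | inner ℝ e w < γ w} :=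
      isOpen_lt (by fun_prop) hγ.continuous
    obtain ⟨w, ⟨hw1, hw2⟩, hw3⟩ := mem_closure_iff.1 hy _ (ho.inter Metric.isOpen_ball) ⟨hlt, hyb⟩
    exact absurd ((hmem' w hw2).1 hw3) (not_lt.2 (le_of_lt hw1))
  have hfront : ∀ y ∈ frontier (Ω : Set (Euc N)), y ∈ Metric.ball x₀ ρ → γ y = inner ℝ e y := by
    intro y hy hyb
    rw [Ω.isOpen.frontier_eq] at hy
    exact le_antisymm (hclos y hy.1 hyb) (not_lt.1 fun h => hy.2 ((hmem' y hyb).2 h))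
  have hL0 : (0 : ℝ) ≤ L := L.2
  set W : Submodule ℝ (Euc N) := (Submodule.span ℝ {e})ᗮ with hWdef
  have he0 : e ≠ 0 := fun h => by simp [h] at he
  have hWr : Module.finrank ℝ W = N - 1 := by
    have h1 := Submodule.finrank_add_finrank_orthogonal (Submodule.span ℝ {e})
    rw [finrank_span_singleton he0, finrank_euclideanSpace_fin, ← hWdef] at h1
    omega
  set P := W.orthogonalProjectionOnto with hP
  have hPval : ∀ x : Euc N, ((P x : W) : Euc N) = x - (inner ℝ e x : ℝ) • e := by
    intro x
    have := Submodule.starProjection_unit_singleton ℝ he x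
    have h2 := Submodule.starProjection_orthogonal_val (K := Submodule.span ℝ {e}) x
    rw [this] at h2
    exact h2
  have hPnorm : ∀ x : Euc N, ‖x - (inner ℝ e x : ℝ) • e‖ = ‖P x‖ := fun x => by
    rw [← hPval]; rfl
  have hP1 : ∀ x : Euc N, ‖P x‖ ≤ ‖x‖ := fun x => W.norm_orthogonalProjectionOnto_apply_le x
  -- With aperture `2 * c = 1 / (2 * (L + 1))` a perturbation `w` in the cone changes `γ` and the
  -- height by at most `t / 2` in total, while moving by `t • e` raises the height by `t`. The radii
  -- `ρ / 4` and `ρ / 8` keep all points in `ball x₀ ρ`.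
  refine ⟨e, 1 / (4 * (L + 1)), ρ / 4, ρ / 8, ((L : ℝ) + 1) ^ (N - 1) *
    ((Measure.euclideanHausdorffMeasure (Module.finrank ℝ W) : Measure W)
      (Metric.ball 0 1)).toReal, by positivity, ?_, he.le, by positivity, by positivity, ?_, ?_⟩
  · rw [div_le_one (by positivity)]; linarith
  · intro x hxc hxb t ht ht8 y hy
    rw [Metric.mem_ball, dist_eq_norm] at hxb
    rw [Metric.mem_closedBall, dist_eq_norm] at hy
    obtain ⟨w, rfl⟩ : ∃ w, y = x + w + t • e := ⟨y - x - t • e, by abel⟩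
    have hw : ‖w‖ ≤ 2 * (1 / (4 * ((L : ℝ) + 1))) * t := by
      refine le_trans (le_of_eq ?_) hy
      congr 1; abel
    have hw' : ((L : ℝ) + 1) * ‖w‖ ≤ t / 2 := by
      calc ((L : ℝ) + 1) * ‖w‖ ≤ (L + 1) * (2 * (1 / (4 * ((L : ℝ) + 1))) * t) := by gcongr
        _ = t / 2 := by field_simp; norm_num
    have hw0 := norm_nonneg w
    have hw2 : ‖w‖ ≤ t / 2 := by nlinarith
    have hte : ‖t • e‖ = t := by rw [norm_smul, he, Real.norm_eq_abs, abs_of_pos ht, mul_one]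
    have hb1 : x + w ∈ Metric.ball x₀ ρ := by
      rw [Metric.mem_ball, dist_eq_norm, show x + w - x₀ = (x - x₀) + w by abel]
      linarith [norm_add_le (x - x₀) w]
    have hb2 : x + w + t • e ∈ Metric.ball x₀ ρ := by
      rw [Metric.mem_ball, dist_eq_norm, show x + w + t • e - x₀ = (x - x₀) + w + t • e by abel]
      linarith [norm_add_le (x - x₀ + w) (t • e), norm_add_le (x - x₀) w]
    have hb3 : x ∈ Metric.ball x₀ ρ := by
      rw [Metric.mem_ball, dist_eq_norm]; linarith
    rw [SetLike.mem_coe, hmem' _ hb2, hinv, inner_add_right, inner_add_right, inner_smul_right,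
      real_inner_self_eq_norm_sq, he]
    have h1 := hLip _ hb1 _ hb3
    rw [add_sub_cancel_left] at h1
    have h2 := hclos x hxc hb3
    have h3 := abs_real_inner_le_norm e w
    rw [he, one_mul] at h3
    have := (abs_le.1 h1).2
    have := (abs_le.1 h3).1
    nlinarith
  · intro p t ht
    rw [surfaceMeasure, Measure.restrict_apply
        (Metric.isOpen_ball.measurableSet.inter Metric.isClosed_closedBall.measurableSet)]
    refine (euclideanHausdorffMeasure_le_of_antilipschitzOn hWr P (L + 1) (q := P p)
      ?_ ht.le ?_).trans ?_
    · rintro x ⟨⟨hx1, -⟩, hx3⟩ y ⟨⟨hy1, -⟩, hy3⟩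
      have hρ4 : Metric.ball x₀ (ρ / 4) ⊆ Metric.ball x₀ ρ :=
        Metric.ball_subset_ball (by linarith)
      rw [dist_eq_norm, dist_eq_norm, ← map_sub, ← hPnorm]
      set a : ℝ := inner ℝ e (x - y) with ha
      -- `γ` does not depend on the height, so `x` may be moved to the height of `y` before the
      -- Lipschitz bound is applied: the height difference `a` is at most `L ‖P (x - y)‖`.
      have hax : γ x = γ (x + (-a) • e) := (hinv x (-a)).symm
      have hb : x + (-a) • e ∈ Metric.ball x₀ ρ := by
        have h1 : ‖x - y - a • e‖ ≤ ‖x - y‖ := by rw [hPnorm]; exact hP1 _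
        rw [Metric.mem_ball, dist_eq_norm] at hx1 hy1 ⊢
        rw [show x + (-a) • e - x₀ = (x - y - a • e) + (y - x₀) by rw [neg_smul]; abel]
        have := norm_add_le (x - y - a • e) (y - x₀)
        have h2 := norm_sub_le (x - x₀) (y - x₀)
        rw [sub_sub_sub_cancel_right] at h2
        linarith
      have h2 := hLip _ hb _ (hρ4 hy1)
      rw [← hax, hfront x hx3 (hρ4 hx1), hfront y hy3 (hρ4 hy1), ← inner_sub_right, ← ha,
        show x + (-a) • e - y = x - y - a • e by rw [neg_smul]; abel] at h2
      have h3 : ‖x - y‖ ≤ ‖x - y - a • e‖ + |a| := by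
        calc ‖x - y‖ = ‖(x - y - a • e) + a • e‖ := by congr 1; abel
          _ ≤ _ := by
            refine (norm_add_le _ _).trans ?_
            rw [norm_smul, he, mul_one, Real.norm_eq_abs]
      push_cast
      linarith
    · rintro x ⟨⟨-, hx2⟩, -⟩
      rw [Metric.mem_closedBall, dist_eq_norm] at hx2
      rw [dist_eq_norm, ← map_sub]
      exact (hP1 _).trans hx2
    · rw [ENNReal.ofReal_mul (by positivity), ENNReal.ofReal_mul (by positivity),
        ENNReal.ofReal_toReal (measure_ball_lt_top).ne,
        ENNReal.ofReal_pow (p := (L + 1 : ℝ)) (by positivity)]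
      have : ENNReal.ofReal ((L : ℝ) + 1) = ((L + 1 : NNReal) : ENNReal) := by
        rw [← NNReal.coe_one, ← NNReal.coe_add, ENNReal.ofReal_coe_nnreal]
      rw [this]
      exact le_of_eq (by ring)

/-! ### Means along an inward direction and their derivatives -/

/-- A smooth probability density `K` supported in the closed ball of center `e` and radius `c`. -/
structure IsMeanKernel {N : ℕ} (e : Euc N) (c : ℝ) (K : Euc N → ℝ) : Prop where
  contDiff : ContDiff ℝ ∞ K
  nonneg : ∀ η, 0 ≤ K η
  mem_closedBall : ∀ η, K η ≠ 0 → η ∈ Metric.closedBall e c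
  integral_eq_one : ∫ η, K η = 1

theorem exists_isMeanKernel {N : ℕ} (e : Euc N) {c : ℝ} (hc : 0 < c) :
    ∃ K, IsMeanKernel e c K := by
  let f : ContDiffBump e := ⟨c / 2, c, by positivity, by linarith⟩
  refine ⟨f.normed volume, f.contDiff_normed, f.nonneg_normed, fun η hη => ?_, f.integral_normed⟩
  have : η ∈ Function.support (f.normed volume) := hη
  rw [f.support_normed_eq] at this
  exact Metric.ball_subset_closedBall this

/-- The density in `y` of `x + t η` when `η` has density `K`. -/
noncomputable def scaledKernel {N : ℕ} (K : Euc N → ℝ) (t : ℝ) (x y : Euc N) : ℝ :=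
  (t ^ N)⁻¹ * K (t⁻¹ • (y - x))

/-- The mean `u_t(x) = ∫ U(x + t η) K(η) dη`, written with the kernel so that it is a convolution.
It averages `U` over a ball of radius of order `t` around `x + t e`. -/
noncomputable def shiftedMean {N : ℕ} (K U : Euc N → ℝ) (t : ℝ) (x : Euc N) : ℝ :=
  ∫ y, U y * scaledKernel K t x y

theorem smul_sub_mem_closedBall_iff {N : ℕ} {e x y : Euc N} {c t : ℝ} (ht : 0 < t) :
    t⁻¹ • (y - x) ∈ Metric.closedBall e c ↔ y ∈ Metric.closedBall (x + t • e) (c * t) := by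
  rw [Metric.mem_closedBall, Metric.mem_closedBall, dist_eq_norm, dist_eq_norm]
  have : t⁻¹ • (y - x) - e = t⁻¹ • (y - (x + t • e)) := by
    rw [← sub_sub, smul_sub t⁻¹ (y - x), inv_smul_smul₀ ht.ne']
  rw [this, norm_smul, norm_inv, Real.norm_eq_abs, abs_of_pos ht, inv_mul_le_iff₀ ht, mul_comm]

theorem hasCompactSupport_of_mem_closedBall {N : ℕ} {e : Euc N} {c : ℝ} {H : Euc N → ℝ}
    (hH : ∀ η, H η ≠ 0 → η ∈ Metric.closedBall e c) : HasCompactSupport H :=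
  HasCompactSupport.of_support_subset_isCompact (isCompact_closedBall e c) fun η hη => hH η hη

theorem exists_testFunction_rescale {N : ℕ} {Ω : Opens (Euc N)} {e x : Euc N} {c t : ℝ}
    {H : Euc N → ℝ} (hH : ContDiff ℝ ∞ H) (hs : ∀ η, H η ≠ 0 → η ∈ Metric.closedBall e c)
    (ht : 0 < t) (hsub : Metric.closedBall (x + t • e) (c * t) ⊆ Ω) :
    ∃ φ : 𝓓(Ω, ℝ), ∀ y, φ y = H (t⁻¹ • (y - x)) := by
  have h : ∀ y, H (t⁻¹ • (y - x)) ≠ 0 → y ∈ Metric.closedBall (x + t • e) (c * t) := fun y hy =>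
    (smul_sub_mem_closedBall_iff ht).1 (hs _ hy)
  refine ⟨⟨fun y => H (t⁻¹ • (y - x)), hH.comp (by fun_prop),
    hasCompactSupport_of_mem_closedBall h, ?_⟩, fun _ => rfl⟩
  exact (closure_minimal (fun y hy => h y hy) Metric.isClosed_closedBall).trans hsub

/-- The integral identity that defines `Du` enters the argument only through this bound. -/
theorem IsBVWithGradient.norm_setIntegral_smul_gradient_le {N : ℕ} {Ω : Opens (Euc N)}
    {u : Euc N → ℝ} {Du : VectorMeasure (Euc N) (Euc N)} (hu : IsBVWithGradient Ω u Du)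
    (φ : 𝓓(Ω, ℝ)) :
    ‖∫ x in Ω, u x • gradient φ x‖ ≤ ∫ x, |φ x| ∂Du.variation := by
  rw [hu.integral_gradient, norm_neg]
  refine VectorMeasure.norm_integral_le_integral_norm.trans ?_
  refine (mul_le_mul_of_nonneg_right (ContinuousLinearMap.opNorm_lsmul_le) ?_).trans ?_
  · exact integral_nonneg fun _ => norm_nonneg _
  · simp

/-- The components `η_i K(η)` of the dilation field weighted by `K`. Their rescalings at scale `r`
move the kernel of `u_r`: its `r`-derivative is minus their divergence (`hasDerivAt_scaledKernel`).
-/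
noncomputable def dilationField {N : ℕ} (K : Euc N → ℝ) (i : Fin N) (η : Euc N) : ℝ := η i * K η

theorem contDiff_dilationField {N : ℕ} {K : Euc N → ℝ} (hK : ContDiff ℝ ∞ K) (i : Fin N) :
    ContDiff ℝ ∞ (dilationField K i) := by
  unfold dilationField
  exact (by fun_prop : ContDiff ℝ ∞ fun η : Euc N => η i).mul hK

theorem sum_fderiv_dilationField {N : ℕ} {K : Euc N → ℝ} (hK : ContDiff ℝ ∞ K) (η : Euc N) :
    ∑ i, fderiv ℝ (dilationField K i) η (EuclideanSpace.single i 1) =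
      N * K η + fderiv ℝ K η η := by
  have hd : DifferentiableAt ℝ K η := hK.differentiable (by simp) η
  have h1 : ∀ i, fderiv ℝ (dilationField K i) η (EuclideanSpace.single i 1) =
      K η + η i * fderiv ℝ K η (EuclideanSpace.single i 1) := by
    intro i
    have hp : HasFDerivAt (fun η : Euc N => η i) (EuclideanSpace.proj i : Euc N →L[ℝ] ℝ) η :=
      (EuclideanSpace.proj i : Euc N →L[ℝ] ℝ).hasFDerivAt
    have := (hp.mul hd.hasFDerivAt).fderiv
    unfold dilationField
    erw [this]
    simp [add_comm]
  simp_rw [h1, Finset.sum_add_distrib]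
  congr 1
  · simp
  · have h2 : η = ∑ i, η i • EuclideanSpace.single i (1 : ℝ) := by
      simpa using ((EuclideanSpace.basisFun (Fin N) ℝ).sum_repr η).symm
    generalize fderiv ℝ K η = T
    conv_rhs => rw [h2]
    simp [map_sum]

theorem fderiv_rescale {N : ℕ} {H : Euc N → ℝ} (hH : ContDiff ℝ ∞ H) (t : ℝ) (x y h : Euc N) :
    fderiv ℝ (fun y => H (t⁻¹ • (y - x))) y h = t⁻¹ * fderiv ℝ H (t⁻¹ • (y - x)) h := by
  have hd : DifferentiableAt ℝ H (t⁻¹ • (y - x)) := hH.differentiable (by simp) _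
  have h1 : HasFDerivAt (fun y => t⁻¹ • (y - x)) (t⁻¹ • ContinuousLinearMap.id ℝ (Euc N)) y :=
    ((hasFDerivAt_id y).sub_const x).const_smul t⁻¹
  have := (hd.hasFDerivAt.comp y h1).fderiv
  erw [this]
  simp

theorem shiftedMean_eq_convolution {N : ℕ} (K U : Euc N → ℝ) (t : ℝ) (x : Euc N) :
    shiftedMean K U t x = (U ⋆[ContinuousLinearMap.lsmul ℝ ℝ, volume]
      fun w => (t ^ N)⁻¹ * K (-(t⁻¹ • w))) x := by
  rw [convolution_def]
  refine integral_congr_ae (Eventually.of_forall fun y => ?_)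
  simp only [scaledKernel, ContinuousLinearMap.lsmul_apply, smul_eq_mul]
  rw [← smul_neg, neg_sub]

theorem norm_le_two_mul_of_inv_smul_mem_closedBall {N : ℕ} {e w : Euc N} {c t : ℝ}
    (hc : c ≤ 1) (he : ‖e‖ ≤ 1) (ht : 0 < t) (hw : t⁻¹ • w ∈ Metric.closedBall e c) :
    ‖w‖ ≤ 2 * t := by
  rw [Metric.mem_closedBall, dist_eq_norm] at hw
  have h1 : ‖t⁻¹ • w‖ ≤ 2 := by
    have := norm_le_norm_sub_add (t⁻¹ • w) e
    linarith
  rw [norm_smul, norm_inv, Real.norm_eq_abs, abs_of_pos ht, inv_mul_le_iff₀ ht] at h1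
  linarith

section
variable {N : ℕ} {e : Euc N} {c : ℝ} {K : Euc N → ℝ}

theorem IsMeanKernel.hasCompactSupport (hK : IsMeanKernel e c K) : HasCompactSupport K :=
  hasCompactSupport_of_mem_closedBall hK.mem_closedBall

theorem IsMeanKernel.contDiff_reflected (hK : IsMeanKernel e c K) (t : ℝ) :
    ContDiff ℝ ∞ (fun w : Euc N => (t ^ N)⁻¹ * K (-(t⁻¹ • w))) :=
  contDiff_const.mul (hK.contDiff.comp (by fun_prop))

theorem IsMeanKernel.hasCompactSupport_reflected (hK : IsMeanKernel e c K) {t : ℝ} (ht : 0 < t) :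
    HasCompactSupport (fun w : Euc N => (t ^ N)⁻¹ * K (-(t⁻¹ • w))) := by
  refine hasCompactSupport_of_mem_closedBall (e := -(t • e)) (c := c * t) fun w hw => ?_
  have := hK.mem_closedBall _ (right_ne_zero_of_mul hw)
  have h2 := (smul_sub_mem_closedBall_iff (x := 0) (y := -w) ht).1 (by simpa using this)
  rw [Metric.mem_closedBall, dist_eq_norm] at h2 ⊢
  rw [← norm_neg]
  refine le_trans (le_of_eq ?_) h2
  congr 1
  abel

theorem IsMeanKernel.contDiff_shiftedMean (hK : IsMeanKernel e c K) {U : Euc N → ℝ}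
    (hU : Integrable U) {t : ℝ} (ht : 0 < t) : ContDiff ℝ ∞ (shiftedMean K U t) := by
  have := (hK.hasCompactSupport_reflected ht).contDiff_convolution_right
    (ContinuousLinearMap.lsmul ℝ ℝ) (μ := volume) (f := U) hU.locallyIntegrable
    (hK.contDiff_reflected t) (n := ⊤)
  have h2 : shiftedMean K U t = (U ⋆[ContinuousLinearMap.lsmul ℝ ℝ, volume]
      fun w => (t ^ N)⁻¹ * K (-(t⁻¹ • w))) := funext fun x => shiftedMean_eq_convolution K U t x
  rw [h2]
  exact this

theorem IsMeanKernel.fderiv_shiftedMean (hK : IsMeanKernel e c K) {U : Euc N → ℝ}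
    (hU : Integrable U) {t : ℝ} (ht : 0 < t) (x h : Euc N) :
    fderiv ℝ (shiftedMean K U t) x h =
      - ((t ^ N)⁻¹ * ∫ y, U y * fderiv ℝ (fun y => K (t⁻¹ • (y - x))) y h) := by
  have hc := hK.hasCompactSupport_reflected ht
  have hg := (hK.contDiff_reflected t)
  have h1 := hc.hasFDerivAt_convolution_right (ContinuousLinearMap.lsmul ℝ ℝ) (μ := volume)
    (f := U) hU.locallyIntegrable (hg.of_le (by simp)) x
  have h2 : shiftedMean K U t = (U ⋆[ContinuousLinearMap.lsmul ℝ ℝ, volume]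
      fun w => (t ^ N)⁻¹ * K (-(t⁻¹ • w))) := funext fun x => shiftedMean_eq_convolution K U t x
  rw [h2, h1.fderiv, convolution_precompR_apply _ hU.locallyIntegrable (hc.fderiv ℝ)
    (hg.continuous_fderiv (by simp)), convolution_def, ← integral_const_mul, ← integral_neg]
  refine integral_congr_ae (Eventually.of_forall fun y => ?_)
  simp only [ContinuousLinearMap.lsmul_apply, smul_eq_mul]
  rw [fderiv_rescale hK.contDiff]
  have hd : DifferentiableAt ℝ K (t⁻¹ • (y - x)) := hK.contDiff.differentiable (by simp) _
  have h3 : HasFDerivAt (fun w : Euc N => -(t⁻¹ • w)) (-(t⁻¹ • ContinuousLinearMap.id ℝ (Euc N)))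
      (x - y) := ((hasFDerivAt_id (x - y)).const_smul t⁻¹).neg
  have h4 : -(t⁻¹ • (x - y)) = t⁻¹ • (y - x) := by rw [← smul_neg, neg_sub]
  rw [← h4] at hd
  have h5 := ((hd.hasFDerivAt.comp (x - y) h3).const_mul (t ^ N)⁻¹).fderiv
  erw [h5]
  simp [h4]
  ring

theorem hasDerivAt_scaledKernel (hK : ContDiff ℝ ∞ K) {r : ℝ} (hr : 0 < r) (x y : Euc N) :
    HasDerivAt (fun r => scaledKernel K r x y)
      (-((r ^ N)⁻¹ * ∑ i, fderiv ℝ (fun y => dilationField K i (r⁻¹ • (y - x))) y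
        (EuclideanSpace.single i 1))) r := by
  simp_rw [fun i => fderiv_rescale (contDiff_dilationField hK i)]
  rw [← Finset.mul_sum, sum_fderiv_dilationField hK]
  have hd : DifferentiableAt ℝ K (r⁻¹ • (y - x)) := hK.differentiable (by simp) _
  have h1 : HasDerivAt (fun r : ℝ => r⁻¹ • (y - x)) ((-(r ^ 2)⁻¹) • (y - x)) r :=
    (hasDerivAt_inv hr.ne').smul_const _
  have h2 := hd.hasFDerivAt.comp_hasDerivAt r h1
  have h3 := ((hasDerivAt_pow N r).inv (pow_ne_zero N hr.ne')).mul h2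
  refine h3.congr_deriv ?_
  rw [map_smul, map_smul]
  simp only [Pi.inv_apply, smul_eq_mul, Function.comp]
  have hrN : r ^ (N - 1) * N = r ^ N * r⁻¹ * N := by
    rcases N with _ | n
    · simp
    · simp only [Nat.add_sub_cancel, pow_succ]; field_simp
  rw [show -((N : ℝ) * r ^ (N - 1)) = - (r ^ N * r⁻¹ * N) by rw [← hrN]; ring]
  field_simp
  ring

/-- Smoothness of the mean in the scale `r`, at fixed `x`, with differentiation under the integral.
-/
theorem IsMeanKernel.contDiffAt_and_hasDerivAt_shiftedMean (hK : IsMeanKernel e c K)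
    (hc : c ≤ 1) (he : ‖e‖ ≤ 1) {U : Euc N → ℝ} (hU : Integrable U) (x : Euc N) {r : ℝ}
    (hr : 0 < r) :
    ContDiffAt ℝ ∞ (fun r => shiftedMean K U r x) r ∧
    HasDerivAt (fun r => shiftedMean K U r x)
      (-((r ^ N)⁻¹ * ∫ y, U y * ∑ i, fderiv ℝ (fun y => dilationField K i (r⁻¹ • (y - x))) y
        (EuclideanSpace.single i 1))) r := by
  -- The mean is a convolution with the kernel `g r`, whose support stays in a fixed compact set for
  -- `r` in the neighbourhood `s` of the given scale.
  let g : ℝ → Euc N → ℝ := fun r w => (r ^ N)⁻¹ * K (-(r⁻¹ • w))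
  let s : Set ℝ := Ioo (r / 2) (2 * r)
  have hs : IsOpen s := isOpen_Ioo
  have hrs : r ∈ s := ⟨by linarith, by linarith⟩
  have hs0 : ∀ p ∈ s, 0 < p := fun p hp => lt_trans (by positivity) hp.1
  have hk : IsCompact (Metric.closedBall (0 : Euc N) (4 * r)) := isCompact_closedBall _ _
  have hgs : ∀ p, ∀ w, p ∈ s → w ∉ Metric.closedBall (0 : Euc N) (4 * r) → g p w = 0 := by
    intro p w hp hw
    by_contra h
    have h1 := hK.mem_closedBall _ (right_ne_zero_of_mul h)
    rw [← smul_neg] at h1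
    have := norm_le_two_mul_of_inv_smul_mem_closedBall hc he (hs0 p hp) h1
    rw [norm_neg] at this
    apply hw
    rw [Metric.mem_closedBall, dist_zero_right]
    linarith [hp.2]
  have hg : ContDiffOn ℝ ∞ (↿g) (s ×ˢ univ) := by
    have h1 : ContDiffOn ℝ ∞ (fun q : ℝ × Euc N => q.1⁻¹) (s ×ˢ univ) :=
      contDiff_fst.contDiffOn.inv fun q hq => (hs0 _ hq.1).ne'
    have h2 : ContDiffOn ℝ ∞ (fun q : ℝ × Euc N => (q.1 ^ N)⁻¹) (s ×ˢ univ) :=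
      (contDiff_fst.pow N).contDiffOn.inv fun q hq => pow_ne_zero _ (hs0 _ hq.1).ne'
    exact h2.mul (hK.contDiff.comp_contDiffOn (h1.smul contDiff_snd.contDiffOn).neg)
  have hfun : (fun r => shiftedMean K U r x) =
      (fun q : ℝ × Euc N => (U ⋆[ContinuousLinearMap.lsmul ℝ ℝ, volume] g q.1) q.2) ∘
        fun r => (r, x) := funext fun r => shiftedMean_eq_convolution K U r x
  constructor
  · have h1 := contDiffOn_convolution_right_with_param (ContinuousLinearMap.lsmul ℝ ℝ)
      (μ := volume) (f := U) (n := ⊤) hs hk hgs hU.locallyIntegrable hg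
    rw [hfun]
    refine ContDiffAt.comp r (h1.contDiffAt ?_) (by fun_prop)
    exact (hs.prod isOpen_univ).mem_nhds ⟨hrs, mem_univ _⟩
  · have h1 := hasFDerivAt_convolution_right_with_param (ContinuousLinearMap.lsmul ℝ ℝ)
      (μ := volume) (f := U) hs hk hgs hU.locallyIntegrable (hg.of_le (by simp)) (r, x) hrs
    have h2 : HasDerivAt (fun r : ℝ => (r, x)) ((1 : ℝ), (0 : Euc N)) r :=
      (hasDerivAt_id r).prodMk (hasDerivAt_const r x)
    have h3 := h1.comp_hasDerivAt r h2
    rw [hfun]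
    refine h3.congr_deriv ?_
    have hfd : ContDiffOn ℝ ∞ (fderiv ℝ (↿g)) (s ×ˢ univ) :=
      hg.fderiv_of_isOpen (hs.prod isOpen_univ) (by simp)
    rw [convolution_precompR_apply, convolution_def, ← integral_const_mul, ← integral_neg]
    · refine integral_congr_ae (Eventually.of_forall fun y => ?_)
      simp only [ContinuousLinearMap.lsmul_apply, smul_eq_mul]
      have hdg : DifferentiableAt ℝ (↿g) (r, x - y) :=
        (hg.differentiableOn (by simp)).differentiableAt
          ((hs.prod isOpen_univ).mem_nhds ⟨hrs, mem_univ _⟩)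
      have h4 : HasDerivAt (fun r : ℝ => (r, x - y)) ((1 : ℝ), (0 : Euc N)) r :=
        (hasDerivAt_id r).prodMk (hasDerivAt_const r (x - y))
      have h5 := hdg.hasFDerivAt.comp_hasDerivAt r h4
      have h6 := hasDerivAt_scaledKernel hK.contDiff hr x y
      have h7 : (↿g ∘ fun r : ℝ => (r, x - y)) = fun r => scaledKernel K r x y := by
        funext r
        simp only [Function.comp, Function.HasUncurry.uncurry, id, g, scaledKernel]
        rw [← smul_neg, neg_sub]
      rw [h7] at h5
      rw [h5.unique h6]
      ring
    · exact hU.locallyIntegrable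
    · refine HasCompactSupport.of_support_subset_isCompact hk fun w hw => ?_
      by_contra hcon
      apply hw
      have : (↿g) =ᶠ[𝓝 (r, w)] fun _ => 0 := by
        have ho : IsOpen (s ×ˢ (Metric.closedBall (0 : Euc N) (4 * r))ᶜ) :=
          hs.prod Metric.isClosed_closedBall.isOpen_compl
        filter_upwards [ho.mem_nhds ⟨hrs, hcon⟩] with q hq
        exact hgs q.1 q.2 hq.1 hq.2
      exact this.fderiv_eq.trans (by simp)
    · exact hfd.continuousOn.comp_continuous (by fun_prop) fun w => ⟨hrs, mem_univ _⟩
end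

/-! ### Bounds by the total variation, and weak convergence of the means -/

theorem TestFunction.integrable_indicator_mul_fderiv {N : ℕ} {Ω : Opens (Euc N)}
    {u : Euc N → ℝ} (hu : IntegrableOn u Ω) (φ : 𝓓(Ω, ℝ)) (h : Euc N) :
    Integrable fun y => (Ω : Set (Euc N)).indicator u y * fderiv ℝ φ y h := by
  have hc : Continuous fun y => fderiv ℝ φ y h :=
    (φ.contDiff.continuous_fderiv (by simp)).clm_apply continuous_const
  obtain ⟨C, hC⟩ := hc.bounded_above_of_compact_support (φ.hasCompactSupport.fderiv_apply ℝ h)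
  exact ((integrable_indicator_iff Ω.isOpen.measurableSet).2 hu).mul_bdd
    hc.aestronglyMeasurable (Eventually.of_forall hC)

theorem IsBVWithGradient.abs_integral_mul_fderiv_le {N : ℕ} {Ω : Opens (Euc N)}
    {u : Euc N → ℝ} {Du : VectorMeasure (Euc N) (Euc N)} (hu : IsBVWithGradient Ω u Du)
    (φ : 𝓓(Ω, ℝ)) (h : Euc N) :
    |∫ y, (Ω : Set (Euc N)).indicator u y * fderiv ℝ φ y h| ≤
      (∫ x, |φ x| ∂Du.variation) * ‖h‖ := by
  have hcg : Continuous fun y => gradient φ y :=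
    (InnerProductSpace.toDual ℝ (Euc N)).symm.continuous.comp
      (φ.contDiff.continuous_fderiv (by simp))
  have hcs : HasCompactSupport fun y => gradient φ y :=
    (φ.hasCompactSupport.fderiv ℝ).comp_left
      (g := (InnerProductSpace.toDual ℝ (Euc N)).symm) (map_zero _)
  obtain ⟨C, hC⟩ := hcg.bounded_above_of_compact_support hcs
  have hint : Integrable (fun y => u y • gradient φ y) (volume.restrict Ω) :=
    hu.integrableOn.smul_bdd C hcg.aestronglyMeasurable (Eventually.of_forall hC)
  have : ∫ y, (Ω : Set (Euc N)).indicator u y * fderiv ℝ φ y h =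
      inner ℝ h (∫ y in Ω, u y • gradient φ y) := by
    rw [← integral_inner hint, ← integral_indicator Ω.isOpen.measurableSet]
    refine integral_congr_ae (Eventually.of_forall fun y => ?_)
    by_cases hy : y ∈ (Ω : Set (Euc N))
    · simp only [indicator_of_mem hy, inner_smul_right]
      rw [real_inner_comm, inner_gradient_left]
    · simp [indicator_of_notMem hy]
  rw [this]
  refine (abs_real_inner_le_norm _ _).trans ?_
  rw [mul_comm]
  gcongr
  exact hu.norm_setIntegral_smul_gradient_le φ

section
variable {N : ℕ} {Ω : Opens (Euc N)} {e : Euc N} {c : ℝ} {K u : Euc N → ℝ}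
  {Du : VectorMeasure (Euc N) (Euc N)}

theorem IsBVWithGradient.integrable_indicator (hu : IsBVWithGradient Ω u Du) :
    Integrable ((Ω : Set (Euc N)).indicator u) :=
  (integrable_indicator_iff Ω.isOpen.measurableSet).2 hu.integrableOn

theorem IsMeanKernel.norm_gradient_shiftedMean_le (hK : IsMeanKernel e c K)
    (hu : IsBVWithGradient Ω u Du) {t : ℝ} (ht : 0 < t) {x : Euc N}
    (hsub : Metric.closedBall (x + t • e) (c * t) ⊆ Ω) :
    ‖gradient (shiftedMean K ((Ω : Set (Euc N)).indicator u) t) x‖ ≤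
      ∫ p, scaledKernel K t x p ∂Du.variation := by
  obtain ⟨φ, hφ⟩ := exists_testFunction_rescale hK.contDiff hK.mem_closedBall ht hsub
  have hφ' : (fun y => K (t⁻¹ • (y - x))) = φ := funext fun y => (hφ y).symm
  have h0 : ∫ p, scaledKernel K t x p ∂Du.variation =
      (t ^ N)⁻¹ * ∫ x, |φ x| ∂Du.variation := by
    rw [← integral_const_mul]
    refine integral_congr_ae (Eventually.of_forall fun y => ?_)
    simp only [hφ, scaledKernel, abs_of_nonneg (hK.nonneg _)]
  rw [h0, gradient, LinearIsometryEquiv.norm_map]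
  refine ContinuousLinearMap.opNorm_le_bound _ ?_ fun h => ?_
  · exact mul_nonneg (by positivity) (integral_nonneg fun _ => abs_nonneg _)
  · rw [hK.fderiv_shiftedMean hu.integrable_indicator ht, norm_neg, norm_mul, hφ',
      Real.norm_of_nonneg (by positivity), mul_assoc]
    gcongr
    exact hu.abs_integral_mul_fderiv_le φ h

theorem IsMeanKernel.abs_deriv_shiftedMean_le (hK : IsMeanKernel e c K) (hc : c ≤ 1)
    (he : ‖e‖ ≤ 1) (hu : IsBVWithGradient Ω u Du) {r : ℝ} (hr : 0 < r) {x : Euc N}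
    (hsub : Metric.closedBall (x + r • e) (c * r) ⊆ Ω) :
    |deriv (fun r => shiftedMean K ((Ω : Set (Euc N)).indicator u) r x) r| ≤
      (r ^ N)⁻¹ * ∑ i, ∫ p, |dilationField K i (r⁻¹ • (p - x))| ∂Du.variation := by
  rw [(hK.contDiffAt_and_hasDerivAt_shiftedMean hc he hu.integrable_indicator x hr).2.deriv,
    abs_neg, abs_mul, abs_of_nonneg (by positivity : (0 : ℝ) ≤ (r ^ N)⁻¹)]
  have hφ : ∀ i, ∃ φ : 𝓓(Ω, ℝ), ∀ y, φ y = dilationField K i (r⁻¹ • (y - x)) := fun i =>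
    exists_testFunction_rescale (contDiff_dilationField hK.contDiff i)
      (fun η hη => hK.mem_closedBall η (right_ne_zero_of_mul hη)) hr hsub
  choose φ hφ using hφ
  have hφ' : ∀ i, (fun y => dilationField K i (r⁻¹ • (y - x))) = φ i :=
    fun i => funext fun y => (hφ i y).symm
  gcongr
  simp_rw [hφ', Finset.mul_sum]
  rw [integral_finsetSum _ fun i _ =>
    TestFunction.integrable_indicator_mul_fderiv hu.integrableOn (φ i) _]
  refine (Finset.abs_sum_le_sum_abs _ _).trans (Finset.sum_le_sum fun i _ => ?_)
  refine (hu.abs_integral_mul_fderiv_le (φ i) _).trans ?_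
  simp [hφ]

/-- Continuity of translations in `L²`, tested against a fixed function. -/
theorem continuous_integral_translate_mul {U g : Euc N → ℝ} (hU : MemLp U 2) (hg : MemLp g 2) :
    Continuous fun w => ∫ x, U (x + w) * g x := by
  let T : C(Euc N, C(Euc N, Euc N)) :=
    (ContinuousMap.mk (fun a : Euc N × Euc N => a.2 + a.1) (by fun_prop)).curry
  have hT : ∀ w, MeasurePreserving (T w) := fun w => measurePreserving_add_right volume w
  have h1 : Continuous fun w => Lp.compMeasurePreserving (T w) (hT w) (hU.toLp U) :=
    continuous_const.compMeasurePreservingLp T.continuous hT (by simp)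
  have h2 : Continuous fun w =>
      inner ℝ (Lp.compMeasurePreserving (T w) (hT w) (hU.toLp U)) (hg.toLp g) :=
    h1.inner continuous_const
  refine h2.congr fun w => ?_
  rw [L2.inner_def]
  refine integral_congr_ae ?_
  filter_upwards [Lp.coeFn_compMeasurePreserving (hU.toLp U) (hT w), hg.coeFn_toLp,
    (hT w).quasiMeasurePreserving.ae_eq_comp hU.coeFn_toLp] with x h1 h2 h3
  rw [h1, h2, h3]
  simp [T, mul_comm]

theorem IsMeanKernel.integral_scaledKernel (hK : IsMeanKernel e c K) {t : ℝ} (ht : 0 < t) :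
    ∫ w, scaledKernel K t 0 w = 1 := by
  simp only [scaledKernel, sub_zero]
  rw [integral_const_mul, Measure.integral_comp_inv_smul, hK.integral_eq_one,
    finrank_euclideanSpace_fin, abs_of_pos (by positivity), smul_eq_mul, mul_one,
    inv_mul_cancel₀ (by positivity)]

theorem scaledKernel_add (t : ℝ) (x w : Euc N) :
    scaledKernel K t x (x + w) = scaledKernel K t 0 w := by
  simp [scaledKernel]

theorem IsMeanKernel.integral_scaledKernel_right (hK : IsMeanKernel e c K) {t : ℝ} (ht : 0 < t)
    (x : Euc N) : ∫ y, scaledKernel K t x y = 1 := by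
  rw [← hK.integral_scaledKernel ht, ← integral_add_left_eq_self _ x]
  simp_rw [scaledKernel_add]

theorem IsMeanKernel.continuous_scaledKernel (hK : IsMeanKernel e c K) (t : ℝ) :
    Continuous fun q : Euc N × Euc N => scaledKernel K t q.1 q.2 := by
  unfold scaledKernel
  exact continuous_const.mul (hK.contDiff.continuous.comp (by fun_prop))

theorem IsMeanKernel.scaledKernel_nonneg (hK : IsMeanKernel e c K) {t : ℝ} (ht : 0 < t)
    (x y : Euc N) : 0 ≤ scaledKernel K t x y :=
  mul_nonneg (by positivity) (hK.nonneg _)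

theorem IsMeanKernel.integrable_scaledKernel (hK : IsMeanKernel e c K) {t : ℝ} (ht : 0 < t)
    (x : Euc N) : Integrable (scaledKernel K t x) := by
  by_contra h
  have := hK.integral_scaledKernel_right ht x
  rw [integral_undef h] at this
  norm_num at this

theorem IsMeanKernel.norm_sub_le_two_mul (hK : IsMeanKernel e c K) (hc : c ≤ 1)
    (he : ‖e‖ ≤ 1) {t : ℝ} (ht : 0 < t) {x y : Euc N} (h : scaledKernel K t x y ≠ 0) :
    ‖y - x‖ ≤ 2 * t :=
  norm_le_two_mul_of_inv_smul_mem_closedBall hc he ht (hK.mem_closedBall _ (right_ne_zero_of_mul h))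

/-- Integrability on the product, from `2 |U g| ≤ U² + g²` and the invariance of Lebesgue measure
under shears. -/
theorem IsMeanKernel.integrable_translate_mul (hK : IsMeanKernel e c K) {U g : Euc N → ℝ}
    (hU : MemLp U 2) (hg : MemLp g 2) {t : ℝ} (ht : 0 < t) :
    Integrable (fun q : Euc N × Euc N => U (q.1 + q.2) * scaledKernel K t 0 q.2 * g q.1)
      (volume.prod volume) := by
  have hk0 := hK.integrable_scaledKernel ht 0
  have h1 : Integrable (fun q : Euc N × Euc N => g q.1 ^ 2 * scaledKernel K t 0 q.2)
      (volume.prod volume) := hg.integrable_sq.mul_prod hk0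
  have hmp : MeasurePreserving (fun q : Euc N × Euc N => (q.1 + q.2, q.2))
      (volume.prod volume) (volume.prod volume) := by
    have h := (measurePreserving_prod_add (volume : Measure (Euc N)) (volume : Measure (Euc N)))
    have h3 := (Measure.measurePreserving_swap (μ := (volume : Measure (Euc N)))
      (ν := (volume : Measure (Euc N))))
    convert! h3.comp (h.comp h3) using 1
    funext q
    simp [add_comm]
  have h2 : Integrable (fun q : Euc N × Euc N => U (q.1 + q.2) ^ 2 * scaledKernel K t 0 q.2)
      (volume.prod volume) :=
    hmp.integrable_comp_of_integrable (g := fun q : Euc N × Euc N => U q.1 ^ 2 *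
      scaledKernel K t 0 q.2) (hU.integrable_sq.mul_prod hk0)
  refine (h1.add h2).mono' ?_ (Eventually.of_forall fun q => ?_)
  · have hm : AEStronglyMeasurable (fun q : Euc N × Euc N => U (q.1 + q.2))
        (volume.prod volume) :=
      (hU.1.comp_fst (ν := volume)).comp_measurePreserving hmp
    exact (hm.mul (hk0.1.comp_snd (μ := volume))).mul (hg.1.comp_fst (ν := volume))
  · simp only [Pi.add_apply]
    have hk := hK.scaledKernel_nonneg ht 0 q.2
    rw [Real.norm_eq_abs, abs_mul, abs_mul, abs_of_nonneg hk]
    nlinarith [sq_nonneg (|U (q.1 + q.2)| - |g q.1|), sq_abs (U (q.1 + q.2)), sq_abs (g q.1),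
      mul_nonneg (abs_nonneg (U (q.1 + q.2))) (abs_nonneg (g q.1)),
      mul_nonneg hk (sq_nonneg (|U (q.1 + q.2)| - |g q.1|)),
      mul_nonneg hk (mul_nonneg (abs_nonneg (U (q.1 + q.2))) (abs_nonneg (g q.1)))]

/-- Weak convergence in `L²` of the means: after exchanging the integrals, the left side is the mean
of the continuous function `w ↦ ∫ U(x + w) g(x) dx`. -/
theorem IsMeanKernel.tendsto_integral_shiftedMean_mul (hK : IsMeanKernel e c K) (hc : c ≤ 1)
    (he : ‖e‖ ≤ 1) {U g : Euc N → ℝ} (hU : MemLp U 2) (hg : MemLp g 2) :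
    Tendsto (fun t => ∫ x, shiftedMean K U t x * g x) (𝓝[>] 0) (𝓝 (∫ x, U x * g x)) := by
  set C : Euc N → ℝ := fun w => ∫ x, U (x + w) * g x with hC
  have hCc : Continuous C := continuous_integral_translate_mul hU hg
  have hC0 : ∫ x, U x * g x = C 0 := by simp [hC]
  rw [hC0, Metric.tendsto_nhdsWithin_nhds]
  intro ε hε
  obtain ⟨δ, hδ, hδC⟩ := Metric.continuous_iff.1 hCc 0 (ε / 2) (by positivity)
  refine ⟨δ / 2, by positivity, fun t ht htδ => ?_⟩
  have ht0 : 0 < t := ht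
  rw [Real.dist_eq, sub_zero, abs_of_pos ht0] at htδ
  have hint := hK.integrable_translate_mul hU hg ht0
  have h1 : ∫ x, shiftedMean K U t x * g x = ∫ w, scaledKernel K t 0 w * C w := by
    calc ∫ x, shiftedMean K U t x * g x
        = ∫ x, ∫ w, U (x + w) * scaledKernel K t 0 w * g x := by
          refine integral_congr_ae (Eventually.of_forall fun x => ?_)
          simp only [shiftedMean]
          rw [← integral_mul_const, ← integral_add_left_eq_self _ x]
          simp_rw [scaledKernel_add]
      _ = ∫ w, ∫ x, U (x + w) * scaledKernel K t 0 w * g x := integral_integral_swap hint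
      _ = _ := by
          refine integral_congr_ae (Eventually.of_forall fun w => ?_)
          simp only [hC]
          rw [← integral_const_mul]
          congr 1; funext x; ring
  have hint2 : Integrable fun w => scaledKernel K t 0 w * C w := by
    refine (hint.integral_prod_right).congr (Eventually.of_forall fun w => ?_)
    simp only [hC]
    rw [← integral_const_mul]
    congr 1; funext x; ring
  have hk0 := hK.integrable_scaledKernel ht0 0
  have h2 : (∫ x, shiftedMean K U t x * g x) - C 0 = ∫ w, scaledKernel K t 0 w * (C w - C 0) := by
    simp_rw [mul_sub]
    rw [h1, integral_sub hint2 (hk0.mul_const _), integral_mul_const,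
      hK.integral_scaledKernel ht0, one_mul]
  rw [Real.dist_eq, h2, ← Real.norm_eq_abs]
  refine lt_of_le_of_lt (norm_integral_le_of_norm_le (hk0.mul_const (ε / 2))
    (Eventually.of_forall fun w => ?_)) ?_
  · rw [norm_mul, Real.norm_of_nonneg (hK.scaledKernel_nonneg ht0 0 w)]
    by_cases hw : scaledKernel K t 0 w = 0
    · simp [hw]
    · refine mul_le_mul_of_nonneg_left ?_ (hK.scaledKernel_nonneg ht0 0 w)
      have := hK.norm_sub_le_two_mul hc he ht0 hw
      refine (hδC w ?_).le
      rw [dist_eq_norm]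
      linarith
  · rw [integral_mul_const, hK.integral_scaledKernel ht0]
    linarith
end

/-! ### Means at boundary points -/

section
variable {N : ℕ} {Ω : Opens (Euc N)} {x₀ e : Euc N} {c r₀ t₀ A : ℝ} {K u τ : Euc N → ℝ}
  {Du : VectorMeasure (Euc N) (Euc N)}

theorem IsConeChart.closedBall_subset_radius_mul (ch : IsConeChart Ω x₀ e c r₀ t₀ A) {x : Euc N}
    (hx : x ∈ closure (Ω : Set (Euc N))) (hxr : x ∈ Metric.ball x₀ r₀) {t : ℝ} (ht : 0 < t)
    (ht0 : t < t₀) : Metric.closedBall (x + t • e) (c * t) ⊆ Ω := by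
  refine (Metric.closedBall_subset_closedBall ?_).trans (ch.closedBall_subset x hx hxr t ht ht0)
  nlinarith [mul_pos ch.c_pos ht]

theorem IsMeanKernel.exists_bound (hK : IsMeanKernel e c K) : ∃ M, 0 < M ∧ ∀ η, K η ≤ M := by
  obtain ⟨M, hM⟩ := hK.contDiff.continuous.bounded_above_of_compact_support hK.hasCompactSupport
  exact ⟨max M 1, by positivity, fun η => ((le_abs_self _).trans (hM η)).trans (le_max_left _ _)⟩

/-- At a point where `u` has the trace value `a`, the means converge to `a`, since the kernel is
supported in `Ω ∩ B(x, 3 t)` and bounded by a multiple of `t⁻ᴺ`. -/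
theorem IsConeChart.tendsto_shiftedMean (ch : IsConeChart Ω x₀ e c r₀ t₀ A)
    (hK : IsMeanKernel e c K) (hu : IsBVWithGradient Ω u Du) {x : Euc N}
    (hx : x ∈ closure (Ω : Set (Euc N))) (hxr : x ∈ Metric.ball x₀ r₀) {a : ℝ}
    (hlim : Tendsto (fun r : ℝ => ⨍ y in (Ω : Set (Euc N)) ∩ Metric.ball x r, |u y - a|)
        (𝓝[>] 0) (𝓝 0)) :
    Tendsto (fun t => shiftedMean K ((Ω : Set (Euc N)).indicator u) t x) (𝓝[>] 0) (𝓝 a) := by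
  obtain ⟨M, hM0, hM⟩ := hK.exists_bound
  -- The ball of radius `3 * t` has volume `(3 * t) ^ N * V`, which cancels the factor `t⁻ᴺ`.
  set V : ℝ := volume.real (Metric.ball (0 : Euc N) 1) with hV
  have h3 : Tendsto (fun t : ℝ => 3 * t) (𝓝[>] 0) (𝓝[>] 0) := by
    refine tendsto_nhdsWithin_iff.2 ⟨?_, ?_⟩
    · have : Tendsto (fun t : ℝ => 3 * t) (𝓝 0) (𝓝 (3 * 0)) :=
        (continuous_const.mul continuous_id).tendsto 0
      rw [mul_zero] at this
      exact this.mono_left nhdsWithin_le_nhds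
    · filter_upwards [self_mem_nhdsWithin] with t ht
      have : (0 : ℝ) < t := ht
      exact mem_Ioi.2 (by positivity)
  have hbound : Tendsto (fun t : ℝ => M * 3 ^ N * V *
      ⨍ y in (Ω : Set (Euc N)) ∩ Metric.ball x (3 * t), |u y - a|) (𝓝[>] 0) (𝓝 0) := by
    simpa using (hlim.comp h3).const_mul (M * 3 ^ N * V)
  refine tendsto_iff_dist_tendsto_zero.2 (squeeze_zero' (Eventually.of_forall fun _ => dist_nonneg)
    ?_ hbound)
  filter_upwards [self_mem_nhdsWithin, nhdsWithin_le_nhds (Iio_mem_nhds ch.t_pos)] with t ht ht0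
  have ht : 0 < t := ht
  have hsub := ch.closedBall_subset_radius_mul hx hxr ht ht0
  set B := (Ω : Set (Euc N)) ∩ Metric.ball x (3 * t) with hB
  have hBm : MeasurableSet B := Ω.isOpen.measurableSet.inter Metric.isOpen_ball.measurableSet
  have hBfin : volume B ≠ ⊤ := (measure_mono inter_subset_right).trans_lt measure_ball_lt_top |>.ne
  have hUint := hu.integrable_indicator
  have hk := hK.integrable_scaledKernel ht x
  have hkM : ∀ y, scaledKernel K t x y ≤ (t ^ N)⁻¹ * M := fun y => by
    unfold scaledKernel; gcongr; exact hM _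
  have hkb : ∀ y, ‖scaledKernel K t x y‖ ≤ (t ^ N)⁻¹ * M := fun y => by
    rw [Real.norm_of_nonneg (hK.scaledKernel_nonneg ht x y)]; exact hkM y
  have hsuppB : ∀ y, scaledKernel K t x y ≠ 0 → y ∈ B := by
    intro y hy
    refine ⟨hsub ((smul_sub_mem_closedBall_iff ht).1
      (hK.mem_closedBall _ (right_ne_zero_of_mul hy))), ?_⟩
    rw [Metric.mem_ball, dist_eq_norm]
    linarith [hK.norm_sub_le_two_mul ch.c_le_one ch.norm_le_one ht hy]
  have hint : Integrable fun y => (Ω : Set (Euc N)).indicator u y * scaledKernel K t x y :=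
    hUint.mul_bdd hk.1 (Eventually.of_forall hkb)
  have h1 : shiftedMean K ((Ω : Set (Euc N)).indicator u) t x - a =
      ∫ y, ((Ω : Set (Euc N)).indicator u y - a) * scaledKernel K t x y := by
    simp_rw [sub_mul]
    rw [integral_sub hint (hk.const_mul a), integral_const_mul,
      hK.integral_scaledKernel_right ht, mul_one, shiftedMean]
  have hintB : IntegrableOn (fun y => |u y - a|) B := by
    refine Integrable.abs (Integrable.sub (hu.integrableOn.mono_set inter_subset_left) ?_)
    exact integrableOn_const hBfin
  rw [Real.dist_eq, h1, ← Real.norm_eq_abs]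
  calc ‖∫ y, ((Ω : Set (Euc N)).indicator u y - a) * scaledKernel K t x y‖
      ≤ ∫ y, B.indicator (fun y => |u y - a| * ((t ^ N)⁻¹ * M)) y := by
        refine norm_integral_le_of_norm_le
          ((integrable_indicator_iff hBm).2 (hintB.mul_const _)) (Eventually.of_forall fun y => ?_)
        by_cases hy : scaledKernel K t x y = 0
        · rw [hy, mul_zero, norm_zero]
          refine indicator_nonneg (fun y _ => ?_) y
          positivity
        · have hyB := hsuppB y hy
          rw [indicator_of_mem hyB, indicator_of_mem hyB.1, norm_mul, Real.norm_eq_abs (u y - a)]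
          gcongr
          exact hkb y
    _ = (t ^ N)⁻¹ * M * (volume.real B * ⨍ y in B, |u y - a|) := by
        rw [integral_indicator hBm, integral_mul_const, mul_comm, ← smul_eq_mul (volume.real B),
          measure_smul_setAverage _ hBfin]
    _ ≤ (t ^ N)⁻¹ * M * (((3 * t) ^ N * V) * ⨍ y in B, |u y - a|) := by
        have hav : 0 ≤ ⨍ y in B, |u y - a| := by
          rw [setAverage_eq]
          exact smul_nonneg (by positivity) (integral_nonneg fun _ => abs_nonneg _)
        gcongr
        refine (measureReal_mono inter_subset_right measure_ball_lt_top.ne).trans (le_of_eq ?_)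
        rw [measureReal_def, Measure.addHaar_ball_of_pos _ _ (by positivity),
          finrank_euclideanSpace_fin, ENNReal.toReal_mul, ENNReal.toReal_ofReal (by positivity)]
        rfl
    _ = _ := by
        rw [mul_pow]
        field_simp

/-- The fundamental theorem of calculus in the scale, with the bound of the `r`-derivative by
`|Du|`. -/
theorem IsMeanKernel.enorm_sub_shiftedMean_le (hK : IsMeanKernel e c K) (hc : c ≤ 1)
    (he : ‖e‖ ≤ 1) (hu : IsBVWithGradient Ω u Du) {s t : ℝ} (hs : 0 < s) (hst : s ≤ t) {x : Euc N}
    (hsub : ∀ r, 0 < r → r ≤ t → Metric.closedBall (x + r • e) (c * r) ⊆ Ω) :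
    ‖shiftedMean K ((Ω : Set (Euc N)).indicator u) t x -
        shiftedMean K ((Ω : Set (Euc N)).indicator u) s x‖ₑ ≤
      ∫⁻ r in Ioc s t, ∫⁻ p, ∑ i,
        ENNReal.ofReal ((r ^ N)⁻¹ * |dilationField K i (r⁻¹ • (p - x))|) ∂Du.variation := by
  have := hu.finite_variation
  set f : ℝ → ℝ := fun r => shiftedMean K ((Ω : Set (Euc N)).indicator u) r x with hf
  have hcd : ContDiffOn ℝ ∞ f (Ioi 0) := fun r hr =>
    (hK.contDiffAt_and_hasDerivAt_shiftedMean hc he hu.integrable_indicator x hr).1.contDiffWithinAt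
  have hsubset : uIcc s t ⊆ Ioi 0 := by
    rw [uIcc_of_le hst]
    exact fun r hr => hs.trans_le hr.1
  have h1 : ∫ r in s..t, deriv f r = f t - f s :=
    intervalIntegral.integral_deriv_eq_sub' f rfl
      (fun r hr => (hK.contDiffAt_and_hasDerivAt_shiftedMean hc he hu.integrable_indicator x
        (hsubset hr)).2.differentiableAt)
      ((hcd.continuousOn_deriv_of_isOpen isOpen_Ioi (by simp)).mono hsubset)
  rw [← h1, intervalIntegral.integral_of_le hst]
  refine (enorm_integral_le_lintegral_enorm _).trans ?_
  refine setLIntegral_mono' measurableSet_Ioc fun r hr => ?_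
  have hr0 : 0 < r := hs.trans hr.1
  have hmeas : ∀ i, Continuous fun p => (r ^ N)⁻¹ * |dilationField K i (r⁻¹ • (p - x))| := fun i =>
    continuous_const.mul ((contDiff_dilationField hK.contDiff i).continuous.comp
      (by fun_prop)).abs
  have hint : ∀ i, Integrable (fun p => (r ^ N)⁻¹ * |dilationField K i (r⁻¹ • (p - x))|)
      Du.variation := by
    intro i
    refine Integrable.const_mul ?_ _
    obtain ⟨C, hC⟩ :=
      (contDiff_dilationField hK.contDiff i).continuous.bounded_above_of_compact_support
      (hasCompactSupport_of_mem_closedBall fun η hη =>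
        hK.mem_closedBall η (right_ne_zero_of_mul hη))
    refine Integrable.of_bound (C := C) ?_ (Eventually.of_forall fun p => ?_)
    · exact ((contDiff_dilationField hK.contDiff i).continuous.comp
        (by fun_prop)).abs.aestronglyMeasurable
    · rw [Real.norm_eq_abs, abs_abs]; exact hC _
  rw [lintegral_finsetSum _ fun i _ => (hmeas i).measurable.ennreal_ofReal, ← ofReal_norm]
  simp_rw [fun i => (ofReal_integral_eq_lintegral_ofReal (hint i)
    (Eventually.of_forall fun p => by positivity)).symm, integral_const_mul]
  rw [← ENNReal.ofReal_sum_of_nonneg fun i _ => by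
    exact mul_nonneg (by positivity) (integral_nonneg fun _ => abs_nonneg _), ← Finset.mul_sum]
  exact ENNReal.ofReal_le_ofReal (hK.abs_deriv_shiftedMean_le hc he hu hr0 (hsub r hr0 hr.2))
end

/-! ### The kernel estimate on the boundary -/

section
variable {N : ℕ} {Ω : Opens (Euc N)} {x₀ e : Euc N} {c r₀ t₀ A : ℝ} {K u τ : Euc N → ℝ}
  {Du : VectorMeasure (Euc N) (Euc N)}

/-- The points of `Ω` at distance at most `2 * t` from the complement of `Ω`. -/
def innerLayer {N : ℕ} (Ω : Opens (Euc N)) (t : ℝ) : Set (Euc N) :=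
  {p | p ∈ Ω ∧ Metric.infDist p (Ω : Set (Euc N))ᶜ ≤ 2 * t}

theorem measurableSet_innerLayer (Ω : Opens (Euc N)) (t : ℝ) : MeasurableSet (innerLayer Ω t) :=
  Ω.isOpen.measurableSet.inter
    (isClosed_le (Metric.continuous_infDist_pt _) continuous_const).measurableSet

theorem tendsto_measure_innerLayer (hne : ((Ω : Set (Euc N))ᶜ).Nonempty) (m : Measure (Euc N))
    [IsFiniteMeasure m] : Tendsto (fun t => m (innerLayer Ω t)) (𝓝[>] 0) (𝓝 0) := by
  have h := tendsto_measure_biInter_gt (μ := m) (s := innerLayer Ω) (a := 0)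
    (fun r _ => (measurableSet_innerLayer Ω r).nullMeasurableSet)
    (fun i j _ hij p hp => ⟨hp.1, hp.2.trans (by linarith)⟩) ⟨1, one_pos, measure_ne_top _ _⟩
  convert! h using 2
  symm
  refine measure_mono_null (t := ∅) ?_ measure_empty
  intro p hp
  simp only [mem_iInter] at hp
  have hpΩ := (hp 1 one_pos).1
  have hpos := (Ω.isOpen.isClosed_compl.notMem_iff_infDist_pos hne).1 (not_not.2 hpΩ)
  have := (hp (Metric.infDist p (Ω : Set (Euc N))ᶜ / 4) (by positivity)).2
  linarith

theorem IsConeChart.isFiniteMeasure (ch : IsConeChart Ω x₀ e c r₀ t₀ A) :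
    IsFiniteMeasure ((surfaceMeasure Ω).restrict (Metric.ball x₀ r₀)) := by
  refine ⟨?_⟩
  rw [Measure.restrict_apply_univ]
  have := ch.surfaceMeasure_le x₀ r₀ ch.r_pos
  rw [inter_eq_left.2 Metric.ball_subset_closedBall] at this
  exact this.trans_lt ENNReal.ofReal_lt_top

theorem ae_surfaceMeasure_mem_frontier (Ω : Opens (Euc N)) :
    ∀ᵐ x ∂(surfaceMeasure Ω), x ∈ frontier (Ω : Set (Euc N)) :=
  ae_restrict_mem isClosed_frontier.measurableSet

/-- A point `p` that the kernel of a boundary point sees at scale `r` has distance to the complement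
of `Ω` comparable to `r`. -/
theorem IsConeChart.infDist_bounds (ch : IsConeChart Ω x₀ e c r₀ t₀ A) {x p : Euc N}
    (hx : x ∈ frontier (Ω : Set (Euc N))) (hxr : x ∈ Metric.ball x₀ r₀) {r : ℝ} (hr : 0 < r)
    (hr0 : r < t₀) (hp : r⁻¹ • (p - x) ∈ Metric.closedBall e c) :
    p ∈ Metric.closedBall x (2 * r) ∧ c * r ≤ Metric.infDist p (Ω : Set (Euc N))ᶜ ∧
      Metric.infDist p (Ω : Set (Euc N))ᶜ ≤ 2 * r := by
  have hxΩ : x ∈ (Ω : Set (Euc N))ᶜ := by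
    rw [Ω.isOpen.frontier_eq] at hx
    exact hx.2
  have h1 : dist p x ≤ 2 * r := by
    rw [dist_eq_norm]
    exact norm_le_two_mul_of_inv_smul_mem_closedBall ch.c_le_one ch.norm_le_one hr hp
  refine ⟨h1, ?_, (Metric.infDist_le_dist_of_mem hxΩ).trans h1⟩
  refine (Metric.le_infDist ⟨x, hxΩ⟩).2 fun {y} hy => ?_
  by_contra! hlt
  apply hy
  apply ch.closedBall_subset x hx.1 hxr r hr hr0
  have h2 := (smul_sub_mem_closedBall_iff hr).1 hp
  rw [Metric.mem_closedBall] at h2 ⊢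
  have := dist_triangle y p (x + r • e)
  rw [dist_comm y p] at this
  linarith

/-- For fixed `p`, the integrand in `r` is of order `1 / r` and vanishes unless `r` is comparable to
the distance `D` of `p` to the complement of `Ω`, so the integral is bounded independently of `p`.
-/
theorem IsConeChart.exists_lintegral_le (hN : 1 ≤ N) (ch : IsConeChart Ω x₀ e c r₀ t₀ A)
    (hK : IsMeanKernel e c K) :
    ∃ C : ENNReal, C ≠ ⊤ ∧ ∀ p ∈ Ω, ∀ s t : ℝ, 0 < s → t < t₀ →
      ∫⁻ r in Ioc s t, ∫⁻ x in Metric.ball x₀ r₀, ∑ i,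
        ENNReal.ofReal ((r ^ N)⁻¹ * |dilationField K i (r⁻¹ • (p - x))|) ∂(surfaceMeasure Ω) ≤
      C * (innerLayer Ω t).indicator 1 p := by
  obtain ⟨M, hM0, hM⟩ := hK.exists_bound
  set C₁ : ℝ := N * (2 * M) * (|A| * 2 ^ (N - 1)) with hC₁
  have hC₁0 : 0 ≤ C₁ := by positivity
  have hc0 := ch.c_pos
  refine ⟨ENNReal.ofReal (2 * C₁ / c), ENNReal.ofReal_ne_top, fun p hp s t hs ht => ?_⟩
  set D := Metric.infDist p (Ω : Set (Euc N))ᶜ with hD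
  -- The measure bound turns `r⁻ᴺ` into `r⁻¹`, on the interval `[D / 2, D / c]`.
  have key : ∀ r ∈ Ioc s t, ∫⁻ x in Metric.ball x₀ r₀, ∑ i,
        ENNReal.ofReal ((r ^ N)⁻¹ * |dilationField K i (r⁻¹ • (p - x))|) ∂(surfaceMeasure Ω) ≤
      {r | c * r ≤ D ∧ D ≤ 2 * r}.indicator (fun r => ENNReal.ofReal (C₁ / r)) r := by
    intro r hr
    have hr0 : 0 < r := hs.trans hr.1
    have hrt : r < t₀ := hr.2.trans_lt ht
    have hpt : ∀ᵐ x ∂(surfaceMeasure Ω).restrict (Metric.ball x₀ r₀), (∑ i,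
        ENNReal.ofReal ((r ^ N)⁻¹ * |dilationField K i (r⁻¹ • (p - x))|)) ≤
        (Metric.closedBall p (2 * r)).indicator (fun _ =>
          {r | c * r ≤ D ∧ D ≤ 2 * r}.indicator
            (fun r => ENNReal.ofReal (N * ((r ^ N)⁻¹ * (2 * M)))) r) x := by
      filter_upwards [ae_restrict_mem Metric.isOpen_ball.measurableSet,
        ae_restrict_of_ae (ae_surfaceMeasure_mem_frontier Ω)] with x hxr hxf
      by_cases hpx : r⁻¹ • (p - x) ∈ Metric.closedBall e c
      · obtain ⟨h1, h2, h3⟩ := ch.infDist_bounds hxf hxr hr0 hrt hpx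
        have hx2 : x ∈ Metric.closedBall p (2 * r) := by rwa [Metric.mem_closedBall_comm]
        have hr2 : r ∈ {r | c * r ≤ D ∧ D ≤ 2 * r} := ⟨h2, h3⟩
        rw [indicator_of_mem hx2, indicator_of_mem hr2]
        have hterm : ∀ i, |dilationField K i (r⁻¹ • (p - x))| ≤ 2 * M := by
          intro i
          rw [dilationField, abs_mul, abs_of_nonneg (hK.nonneg _)]
          have hn : ‖r⁻¹ • (p - x)‖ ≤ 2 := by
            rw [Metric.mem_closedBall, dist_eq_norm] at hpx
            have := norm_le_norm_sub_add (r⁻¹ • (p - x)) e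
            linarith [ch.c_le_one, ch.norm_le_one]
          have hi := (PiLp.norm_apply_le (r⁻¹ • (p - x)) i).trans hn
          rw [Real.norm_eq_abs] at hi
          gcongr
          · exact hK.nonneg _
          · exact hM _
        calc (∑ i, ENNReal.ofReal ((r ^ N)⁻¹ * |dilationField K i (r⁻¹ • (p - x))|))
            ≤ ∑ i : Fin N, ENNReal.ofReal ((r ^ N)⁻¹ * (2 * M)) := by
              gcongr with i
              exact hterm i
          _ = _ := by
              rw [Finset.sum_const, Finset.card_univ, Fintype.card_fin, nsmul_eq_mul,
                ENNReal.ofReal_mul (p := (N : ℝ)) (by positivity), ENNReal.ofReal_natCast]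
      · have hz : ∀ i, dilationField K i (r⁻¹ • (p - x)) = 0 := fun i => by
          by_contra h
          exact hpx (hK.mem_closedBall _ (right_ne_zero_of_mul h))
        simp [hz]
    refine (lintegral_mono_ae hpt).trans ?_
    rw [lintegral_indicator_const Metric.isClosed_closedBall.measurableSet,
      Measure.restrict_apply Metric.isClosed_closedBall.measurableSet, inter_comm]
    by_cases hmem : r ∈ {r | c * r ≤ D ∧ D ≤ 2 * r}
    · rw [indicator_of_mem hmem, indicator_of_mem hmem]
      calc _ ≤ ENNReal.ofReal (N * ((r ^ N)⁻¹ * (2 * M))) *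
            ENNReal.ofReal (|A| * (2 * r) ^ (N - 1)) := by
            gcongr
            refine (ch.surfaceMeasure_le p (2 * r) (by positivity)).trans ?_
            gcongr
            exact le_abs_self A
        _ = _ := by
            rw [← ENNReal.ofReal_mul (by positivity)]
            congr 1
            obtain ⟨n, rfl⟩ : ∃ n, N = n + 1 := ⟨N - 1, by omega⟩
            simp only [hC₁, Nat.add_sub_cancel, mul_pow, pow_succ]
            field_simp
    · rw [indicator_of_notMem hmem, indicator_of_notMem hmem, zero_mul]
  refine (setLIntegral_mono' measurableSet_Ioc key).trans ?_
  by_cases hpl : p ∈ innerLayer Ω t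
  · rw [indicator_of_mem hpl, Pi.one_apply, mul_one]
    by_cases hne : ((Ω : Set (Euc N))ᶜ).Nonempty
    · have hD0 : 0 < D := (Ω.isOpen.isClosed_compl.notMem_iff_infDist_pos hne).1 (not_not.2 hp)
      calc _ ≤ ∫⁻ r, (Icc (D / 2) (D / c)).indicator (fun _ => ENNReal.ofReal (2 * C₁ / D)) r := by
            refine (setLIntegral_le_lintegral _ _).trans (lintegral_mono fun r => ?_)
            by_cases hmem : r ∈ {r | c * r ≤ D ∧ D ≤ 2 * r}
            · have hD2 : D / 2 ≤ r := by linarith [hmem.2]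
              have hIcc : r ∈ Icc (D / 2) (D / c) :=
                ⟨hD2, by rw [le_div_iff₀ hc0]; linarith [hmem.1]⟩
              rw [indicator_of_mem hmem, indicator_of_mem hIcc]
              apply ENNReal.ofReal_le_ofReal
              rw [div_le_div_iff₀ (by linarith) hD0]
              nlinarith
            · rw [indicator_of_notMem hmem]
              exact zero_le
        _ = ENNReal.ofReal (2 * C₁ / D) * ENNReal.ofReal (D / c - D / 2) := by
            rw [lintegral_indicator_const measurableSet_Icc, Real.volume_Icc]
        _ ≤ _ := by
            rw [← ENNReal.ofReal_mul (by positivity)]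
            apply ENNReal.ofReal_le_ofReal
            calc 2 * C₁ / D * (D / c - D / 2) ≤ 2 * C₁ / D * (D / c) := by
                  gcongr; linarith
              _ = _ := by field_simp
    · have hD0 : D = 0 := by
        rw [hD, not_nonempty_iff_eq_empty.1 hne, Metric.infDist_empty]
      -- Without a complement `infDist` has the junk value `0`, which excludes every `r > 0`.
      have : ∫⁻ r in Ioc s t, {r | c * r ≤ D ∧ D ≤ 2 * r}.indicator
          (fun r => ENNReal.ofReal (C₁ / r)) r = ∫⁻ r in Ioc s t, 0 := by
        refine setLIntegral_congr_fun measurableSet_Ioc fun r hr => ?_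
        refine indicator_of_notMem (fun h => ?_) _
        have := h.1
        have := mul_pos hc0 (hs.trans hr.1)
        linarith
      rw [this]; simp
  · have : ∫⁻ r in Ioc s t, {r | c * r ≤ D ∧ D ≤ 2 * r}.indicator
        (fun r => ENNReal.ofReal (C₁ / r)) r = ∫⁻ r in Ioc s t, 0 := by
      refine setLIntegral_congr_fun measurableSet_Ioc fun r hr => ?_
      refine indicator_of_notMem (fun h => hpl ⟨hp, ?_⟩) _
      linarith [h.2, hr.2]
    rw [this]; simp
end

/-! ### Convergence of the means to the trace -/

section
variable {N : ℕ} {Ω : Opens (Euc N)} {x₀ e : Euc N} {c r₀ t₀ A : ℝ} {K u τ : Euc N → ℝ}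
  {Du : VectorMeasure (Euc N) (Euc N)}

/-- The means form a Cauchy family in `L¹(∂Ω)`, locally. -/
theorem IsConeChart.exists_lintegral_sub_shiftedMean_le (hN : 1 ≤ N)
    (ch : IsConeChart Ω x₀ e c r₀ t₀ A) (hK : IsMeanKernel e c K)
    (hu : IsBVWithGradient Ω u Du) :
    ∃ C : ENNReal, C ≠ ⊤ ∧ ∀ s t : ℝ, 0 < s → s ≤ t → t < t₀ →
      ∫⁻ x in Metric.ball x₀ r₀, ‖shiftedMean K ((Ω : Set (Euc N)).indicator u) t x -
        shiftedMean K ((Ω : Set (Euc N)).indicator u) s x‖ₑ ∂(surfaceMeasure Ω) ≤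
      C * Du.variation (innerLayer Ω t) := by
  have := hu.finite_variation
  have := ch.isFiniteMeasure
  obtain ⟨C, hC, hCle⟩ := ch.exists_lintegral_le hN hK
  refine ⟨C, hC, fun s t hs hst ht => ?_⟩
  -- By Tonelli's theorem the integration over `x` and `r` is carried out first, at fixed `p`.
  set F : Euc N → ℝ → Euc N → ENNReal := fun x r p =>
    ∑ i, ENNReal.ofReal ((r ^ N)⁻¹ * |dilationField K i (r⁻¹ • (p - x))|) with hF
  have hFm : Measurable fun q : (Euc N × ℝ) × Euc N => F q.1.1 q.1.2 q.2 := by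
    refine Finset.measurable_sum _ fun i _ => Measurable.ennreal_ofReal ?_
    refine Measurable.mul (by fun_prop) (continuous_abs.measurable.comp ?_)
    exact (contDiff_dilationField hK.contDiff i).continuous.measurable.comp (by fun_prop)
  calc ∫⁻ x in Metric.ball x₀ r₀, ‖shiftedMean K ((Ω : Set (Euc N)).indicator u) t x -
        shiftedMean K ((Ω : Set (Euc N)).indicator u) s x‖ₑ ∂(surfaceMeasure Ω)
      ≤ ∫⁻ x in Metric.ball x₀ r₀, (∫⁻ r in Ioc s t, ∫⁻ p, F x r p ∂Du.variation)
          ∂(surfaceMeasure Ω) := by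
        refine lintegral_mono_ae ?_
        filter_upwards [ae_restrict_mem Metric.isOpen_ball.measurableSet,
          ae_restrict_of_ae (ae_surfaceMeasure_mem_frontier Ω)] with x hxr hxf
        exact hK.enorm_sub_shiftedMean_le ch.c_le_one ch.norm_le_one hu hs hst fun r hr hrt =>
          ch.closedBall_subset_radius_mul hxf.1 hxr hr (hrt.trans_lt ht)
    _ = ∫⁻ r in Ioc s t, ∫⁻ x in Metric.ball x₀ r₀, ∫⁻ p, F x r p ∂Du.variation
          ∂(surfaceMeasure Ω) := by
        refine lintegral_lintegral_swap (Measurable.aemeasurable ?_)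
        exact hFm.lintegral_prod_right'
    _ = ∫⁻ r in Ioc s t, ∫⁻ p, ∫⁻ x in Metric.ball x₀ r₀, F x r p
          ∂(surfaceMeasure Ω) ∂Du.variation := by
        refine lintegral_congr fun r => ?_
        refine lintegral_lintegral_swap (Measurable.aemeasurable ?_)
        exact hFm.comp (g := fun q : (Euc N × ℝ) × Euc N => F q.1.1 q.1.2 q.2)
          (f := fun q : Euc N × Euc N => ((q.1, r), q.2)) (by fun_prop)
    _ = ∫⁻ p, (∫⁻ r in Ioc s t, ∫⁻ x in Metric.ball x₀ r₀, F x r p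
          ∂(surfaceMeasure Ω)) ∂Du.variation := by
        refine lintegral_lintegral_swap (Measurable.aemeasurable ?_)
        have h := hFm.comp (g := fun q : (Euc N × ℝ) × Euc N => F q.1.1 q.1.2 q.2)
          (f := fun q : (ℝ × Euc N) × Euc N => ((q.2, q.1.1), q.1.2)) (by fun_prop)
        exact h.lintegral_prod_right'
    _ ≤ ∫⁻ p, C * (innerLayer Ω t).indicator 1 p ∂Du.variation := by
        refine lintegral_mono_ae ?_
        have hmem : ∀ᵐ p ∂Du.variation, p ∈ (Ω : Set (Euc N)) := by
          rw [ae_iff]; exact hu.variation_compl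
        filter_upwards [hmem] with p hp
        exact hCle p hp s t hs ht
    _ = C * Du.variation (innerLayer Ω t) := by
        rw [lintegral_const_mul _ (measurable_one.indicator (measurableSet_innerLayer Ω t)),
          lintegral_indicator_one (measurableSet_innerLayer Ω t)]

/-- Convergence of the means to the trace in `L¹(∂Ω)`, locally: Fatou's lemma for the almost
everywhere limit of the Cauchy family. -/
theorem IsConeChart.exists_lintegral_sub_trace_le (hN : 1 ≤ N)
    (ch : IsConeChart Ω x₀ e c r₀ t₀ A) (hK : IsMeanKernel e c K)
    (hu : IsBVWithGradient Ω u Du) (htr : HasBoundaryTrace Ω u τ) :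
    ∃ C : ENNReal, C ≠ ⊤ ∧ ∀ t : ℝ, 0 < t → t < t₀ →
      ∫⁻ x in Metric.ball x₀ r₀, ‖shiftedMean K ((Ω : Set (Euc N)).indicator u) t x -
        τ x‖ₑ ∂(surfaceMeasure Ω) ≤ C * Du.variation (innerLayer Ω t) := by
  obtain ⟨C, hC, hCle⟩ := ch.exists_lintegral_sub_shiftedMean_le hN hK hu
  refine ⟨C, hC, fun t ht ht0 => ?_⟩
  set w := shiftedMean K ((Ω : Set (Euc N)).indicator u) with hw
  let s : ℕ → ℝ := fun n => t / (n + 1)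
  have hs0 : ∀ n, 0 < s n := fun n => by positivity
  have hst : ∀ n, s n ≤ t := fun n => div_le_self ht.le (by linarith [n.cast_nonneg (α := ℝ)])
  have hs : Tendsto s atTop (𝓝[>] 0) :=
    tendsto_nhdsWithin_iff.2 ⟨by
      simpa [Function.comp_def, s] using
        (tendsto_const_div_atTop_nhds_zero_nat t).comp (tendsto_add_atTop_nat 1),
      Eventually.of_forall hs0⟩
  have hwc : ∀ r, 0 < r → Continuous (w r) := fun r hr =>
    (hK.contDiff_shiftedMean hu.integrable_indicator hr).continuous
  calc ∫⁻ x in Metric.ball x₀ r₀, ‖w t x - τ x‖ₑ ∂(surfaceMeasure Ω)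
      = ∫⁻ x in Metric.ball x₀ r₀, liminf (fun n => ‖w t x - w (s n) x‖ₑ) atTop
          ∂(surfaceMeasure Ω) := by
        refine lintegral_congr_ae ?_
        filter_upwards [ae_restrict_mem Metric.isOpen_ball.measurableSet,
          ae_restrict_of_ae (ae_surfaceMeasure_mem_frontier Ω),
          ae_restrict_of_ae htr.2] with x hxr hxf hx
        have h1 := (ch.tendsto_shiftedMean hK hu hxf.1 hxr hx).comp hs
        exact ((tendsto_const_nhds.sub h1).enorm.liminf_eq).symm
    _ ≤ liminf (fun n => ∫⁻ x in Metric.ball x₀ r₀, ‖w t x - w (s n) x‖ₑ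
          ∂(surfaceMeasure Ω)) atTop := by
        refine lintegral_liminf_le fun n => ?_
        exact ((hwc t ht).sub (hwc _ (hs0 n))).measurable.enorm
    _ ≤ liminf (fun _ : ℕ => C * Du.variation (innerLayer Ω t)) atTop := by
        refine liminf_le_liminf (Eventually.of_forall fun n => ?_)
        exact hCle (s n) t (hs0 n) (hst n) ht0
    _ = _ := by simp

theorem IsConeChart.tendsto_integral_mul_shiftedMean (hN : 1 ≤ N)
    (ch : IsConeChart Ω x₀ e c r₀ t₀ A) (hne : ((Ω : Set (Euc N))ᶜ).Nonempty)
    (hK : IsMeanKernel e c K)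
    (hu : IsBVWithGradient Ω u Du) (htr : HasBoundaryTrace Ω u τ) {f : Euc N → ℝ}
    (hf : AEStronglyMeasurable f (surfaceMeasure Ω)) {B : ℝ}
    (hfB : ∀ᵐ x ∂(surfaceMeasure Ω), |f x| ≤ B) (hfs : ∀ x ∉ Metric.ball x₀ r₀, f x = 0) :
    Tendsto (fun t => ∫ x, f x * shiftedMean K ((Ω : Set (Euc N)).indicator u) t x
      ∂(surfaceMeasure Ω)) (𝓝[>] 0) (𝓝 (∫ x, f x * τ x ∂(surfaceMeasure Ω))) := by
  have := hu.finite_variation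
  obtain ⟨C, hC, hCle⟩ := ch.exists_lintegral_sub_trace_le hN hK hu htr
  set w := shiftedMean K ((Ω : Set (Euc N)).indicator u) with hw
  have hset : ∀ g : Euc N → ℝ, ∫ x, f x * g x ∂(surfaceMeasure Ω) =
      ∫ x in Metric.ball x₀ r₀, f x * g x ∂(surfaceMeasure Ω) := fun g =>
    (setIntegral_eq_integral_of_forall_compl_eq_zero fun x hx => by rw [hfs x hx, zero_mul]).symm
  simp_rw [hset]
  have hlim : Tendsto (fun t => ENNReal.ofReal B * (C * Du.variation (innerLayer Ω t)))
      (𝓝[>] 0) (𝓝 0) := by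
    have h1 := ENNReal.Tendsto.const_mul (a := ENNReal.ofReal B * C)
      (tendsto_measure_innerLayer hne Du.variation)
      (Or.inr (ENNReal.mul_ne_top ENNReal.ofReal_ne_top hC))
    simpa [mul_assoc] using h1
  have hfτ : Integrable (fun x => f x * τ x)
      ((surfaceMeasure Ω).restrict (Metric.ball x₀ r₀)) :=
    (htr.1.bdd_mul hf hfB).restrict
  have hev : ∀ᶠ t in 𝓝[>] (0 : ℝ), 0 < t ∧ t < t₀ := by
    filter_upwards [self_mem_nhdsWithin, nhdsWithin_le_nhds (Iio_mem_nhds ch.t_pos)] with t ht ht0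
    exact ⟨ht, ht0⟩
  have hbd : ∀ t, 0 < t → t < t₀ → ∫⁻ x in Metric.ball x₀ r₀, ‖f x * w t x - f x * τ x‖ₑ
      ∂(surfaceMeasure Ω) ≤ ENNReal.ofReal B * (C * Du.variation (innerLayer Ω t)) := by
    intro t ht ht0
    calc _ ≤ ∫⁻ x in Metric.ball x₀ r₀, ENNReal.ofReal B * ‖w t x - τ x‖ₑ
          ∂(surfaceMeasure Ω) := by
          refine lintegral_mono_ae ?_
          filter_upwards [ae_restrict_of_ae hfB] with x hx
          rw [← mul_sub, enorm_mul]
          gcongr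
          rw [← ofReal_norm]
          exact ENNReal.ofReal_le_ofReal hx
      _ = ENNReal.ofReal B * ∫⁻ x in Metric.ball x₀ r₀, ‖w t x - τ x‖ₑ
          ∂(surfaceMeasure Ω) := by
          rw [lintegral_const_mul' _ _ ENNReal.ofReal_ne_top]
      _ ≤ _ := by
          gcongr
          exact hCle t ht ht0
  refine tendsto_integral_of_L1 _ hfτ.1 ?_ ?_
  · have hfin : ∀ᶠ t in 𝓝[>] (0 : ℝ),
        ENNReal.ofReal B * (C * Du.variation (innerLayer Ω t)) < ⊤ :=
      hlim.eventually (gt_mem_nhds ENNReal.zero_lt_top)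
    filter_upwards [hev, hfin] with t ht htfin
    have hwm : AEStronglyMeasurable (w t) ((surfaceMeasure Ω).restrict (Metric.ball x₀ r₀)) :=
      (hK.contDiff_shiftedMean hu.integrable_indicator ht.1).continuous.aestronglyMeasurable
    have h1 : Integrable (fun x => f x * w t x - f x * τ x)
        ((surfaceMeasure Ω).restrict (Metric.ball x₀ r₀)) :=
      ⟨(hf.restrict.mul hwm).sub hfτ.1, (hbd t ht.1 ht.2).trans_lt htfin⟩
    exact (h1.add hfτ).congr (Eventually.of_forall fun x => by simp)
  · refine tendsto_of_tendsto_of_tendsto_of_le_of_le' tendsto_const_nhds hlim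
      (Eventually.of_forall fun _ => zero_le) ?_
    filter_upwards [hev] with t ht
    exact hbd t ht.1 ht.2
end

/-! ### The local Green estimate -/

section
variable {N : ℕ} {Ω : Opens (Euc N)} {x₀ e : Euc N} {c r₀ t₀ A : ℝ} {K u τ d v : Euc N → ℝ}
  {z : Euc N → Euc N} {Du : VectorMeasure (Euc N) (Euc N)}

theorem IsMeanKernel.lintegral_scaledKernel_left (hK : IsMeanKernel e c K) {t : ℝ} (ht : 0 < t)
    (p : Euc N) : ∫⁻ x, ENNReal.ofReal (scaledKernel K t x p) = 1 := by
  have h : ∀ x, scaledKernel K t x p = scaledKernel K t 0 (p - x) := fun x => by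
    simp [scaledKernel]
  simp_rw [h]
  rw [lintegral_sub_left_eq_self (fun w => ENNReal.ofReal (scaledKernel K t 0 w)) p,
    ← ofReal_integral_eq_lintegral_ofReal (hK.integrable_scaledKernel ht 0)
      (Eventually.of_forall fun w => hK.scaledKernel_nonneg ht 0 w),
    hK.integral_scaledKernel ht, ENNReal.ofReal_one]

theorem ContDiff.continuous_gradient {χ : Euc N → ℝ} (hχ : ContDiff ℝ ∞ χ) :
    Continuous (gradient χ) :=
  (InnerProductSpace.toDual ℝ (Euc N)).symm.continuous.comp (hχ.continuous_fderiv (by simp))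

theorem HasCompactSupport.gradient {χ : Euc N → ℝ} (hχ : HasCompactSupport χ) :
    HasCompactSupport (gradient χ) :=
  (hχ.fderiv ℝ).comp_left (g := (InnerProductSpace.toDual ℝ (Euc N)).symm) (map_zero _)

theorem gradient_mul_apply {f g : Euc N → ℝ} (hf : ContDiff ℝ ∞ f) (hg : ContDiff ℝ ∞ g)
    (x : Euc N) : gradient (fun y => f y * g y) x = f x • gradient g x + g x • gradient f x := by
  have h := ((hf.differentiable (by simp) x).hasFDerivAt.mul
    (hg.differentiable (by simp) x).hasFDerivAt).fderiv
  unfold gradient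
  erw [h]
  simp

theorem IsUnitBoundedField.integrable_inner (hz : IsUnitBoundedField Ω z) {G : Euc N → Euc N}
    (hG : Continuous G) (hGs : HasCompactSupport G) :
    Integrable (fun x => (inner ℝ (z x) (G x) : ℝ)) (volume.restrict Ω) := by
  refine ((hG.integrable_of_hasCompactSupport hGs).norm.restrict (s := (Ω : Set (Euc N)))).mono'
    (hz.1.inner hG.aestronglyMeasurable) ?_
  filter_upwards [hz.2] with x hx
  refine (norm_inner_le_norm _ _).trans ?_
  nlinarith [norm_nonneg (G x)]

/-- The total variation bound for `∫_Ω χ z · ∇u_t`: the kernel has integral one also in its first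
variable, and `χ` oscillates by at most `ε` at scale `2 * t`. -/
theorem IsConeChart.enorm_integral_mul_inner_gradient_le (ch : IsConeChart Ω x₀ e c r₀ t₀ A)
    (hK : IsMeanKernel e c K) (hu : IsBVWithGradient Ω u Du) (hz : IsUnitBoundedField Ω z)
    {χ : Euc N → ℝ} (hχ : Continuous χ) (hsub : tsupport χ ⊆ Metric.ball x₀ r₀) {t ε : ℝ}
    (ht : 0 < t) (ht0 : t < t₀) (hε : ∀ x p : Euc N, ‖p - x‖ ≤ 2 * t → |χ x| ≤ |χ p| + ε) :
    ‖∫ x in Ω, χ x * inner ℝ (z x)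
      (gradient (shiftedMean K ((Ω : Set (Euc N)).indicator u) t) x)‖ₑ ≤
      ∫⁻ p, ENNReal.ofReal (|χ p| + ε) ∂Du.variation := by
  have := hu.finite_variation
  have hkm : Measurable fun q : Euc N × Euc N => ENNReal.ofReal (scaledKernel K t q.1 q.2) :=
    (hK.continuous_scaledKernel t).measurable.ennreal_ofReal
  calc ‖∫ x in Ω, χ x * inner ℝ (z x)
        (gradient (shiftedMean K ((Ω : Set (Euc N)).indicator u) t) x)‖ₑ
      ≤ ∫⁻ x in Ω, ∫⁻ p, ENNReal.ofReal |χ x| * ENNReal.ofReal (scaledKernel K t x p)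
          ∂Du.variation := by
        refine (enorm_integral_le_lintegral_enorm _).trans (lintegral_mono_ae ?_)
        filter_upwards [hz.2, ae_restrict_mem Ω.isOpen.measurableSet] with x hzx hxΩ
        rw [lintegral_const_mul' _ _ ENNReal.ofReal_ne_top, enorm_mul, ← Real.norm_eq_abs,
          ofReal_norm]
        by_cases hx : χ x = 0
        · simp [hx]
        have hxb : x ∈ Metric.ball x₀ r₀ := hsub (subset_tsupport χ hx)
        have hint : Integrable (scaledKernel K t x) Du.variation := by
          obtain ⟨M, hM0, hM⟩ := hK.exists_bound
          refine Integrable.of_bound (C := (t ^ N)⁻¹ * M)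
            ((hK.continuous_scaledKernel t).comp
              (Continuous.prodMk_right x)).aestronglyMeasurable (Eventually.of_forall fun p => ?_)
          rw [Real.norm_of_nonneg (hK.scaledKernel_nonneg ht x p), scaledKernel]
          gcongr
          exact hM _
        rw [← ofReal_integral_eq_lintegral_ofReal hint
          (Eventually.of_forall fun p => hK.scaledKernel_nonneg ht x p)]
        gcongr
        rw [← ofReal_norm]
        apply ENNReal.ofReal_le_ofReal
        refine (norm_inner_le_norm _ _).trans ((mul_le_of_le_one_left (norm_nonneg _) hzx).trans ?_)
        exact hK.norm_gradient_shiftedMean_le hu ht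
          (ch.closedBall_subset_radius_mul (subset_closure hxΩ) hxb ht ht0)
    _ ≤ ∫⁻ x, ∫⁻ p, ENNReal.ofReal |χ x| * ENNReal.ofReal (scaledKernel K t x p)
          ∂Du.variation := setLIntegral_le_lintegral _ _
    _ = ∫⁻ p, (∫⁻ x, ENNReal.ofReal |χ x| * ENNReal.ofReal (scaledKernel K t x p))
          ∂Du.variation := by
        refine lintegral_lintegral_swap (Measurable.aemeasurable ?_)
        exact (hχ.abs.measurable.ennreal_ofReal.comp measurable_fst).mul hkm
    _ ≤ ∫⁻ p, ENNReal.ofReal (|χ p| + ε) ∂Du.variation := by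
        refine lintegral_mono fun p => ?_
        calc ∫⁻ x, ENNReal.ofReal |χ x| * ENNReal.ofReal (scaledKernel K t x p)
            ≤ ∫⁻ x, ENNReal.ofReal (|χ p| + ε) * ENNReal.ofReal (scaledKernel K t x p) := by
              refine lintegral_mono fun x => ?_
              by_cases hk : scaledKernel K t x p = 0
              · simp [hk]
              · gcongr
                exact hε x p (hK.norm_sub_le_two_mul ch.c_le_one ch.norm_le_one ht hk)
          _ = _ := by
              rw [lintegral_const_mul' _ _ ENNReal.ofReal_ne_top,
                hK.lintegral_scaledKernel_left ht, mul_one]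

theorem exists_testFunction_eq {f : Euc N → ℝ} (hf : ContDiff ℝ ∞ f) (hfs : HasCompactSupport f)
    (hsub : tsupport f ⊆ Ω) : ∃ φ : 𝓓(Ω, ℝ), (φ : Euc N → ℝ) = f :=
  ⟨⟨f, hf, hfs, hsub⟩, rfl⟩

/-- The normal trace identity tested with the product `f * g`. -/
theorem HasNormalTrace.integral_mul_inner_gradient (hnt : HasNormalTrace Ω z d v)
    (hz : IsUnitBoundedField Ω z) {f g : Euc N → ℝ} (hf : ContDiff ℝ ∞ f)
    (hfs : HasCompactSupport f) (hg : ContDiff ℝ ∞ g) :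
    ∫ x in Ω, f x * inner ℝ (z x) (gradient g x) =
      (∫ x, v x * f x * g x ∂(surfaceMeasure Ω)) - (∫ x in Ω, g x * (f x * d x)) -
        ∫ x in Ω, g x * inner ℝ (z x) (gradient f x) := by
  obtain ⟨φ, hφ⟩ := exists_testFunction_eq (Ω := ⊤) (f := fun x => f x * g x) (hf.mul hg)
    hfs.mul_right (subset_univ _)
  have h := hnt.2 φ
  have hi1 : Integrable (fun x => (inner ℝ (z x) (f x • gradient g x) : ℝ))
      (volume.restrict Ω) :=
    hz.integrable_inner (hf.continuous.smul hg.continuous_gradient)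
      (hfs.mono fun x hx => left_ne_zero_of_smul hx)
  have hi2 : Integrable (fun x => (inner ℝ (z x) (g x • gradient f x) : ℝ))
      (volume.restrict Ω) :=
    hz.integrable_inner (hg.continuous.smul hf.continuous_gradient)
      (hfs.gradient.mono fun x hx => right_ne_zero_of_smul hx)
  rw [hφ] at h
  simp_rw [gradient_mul_apply hf hg, inner_add_right] at h
  rw [integral_add hi1 hi2] at h
  simp_rw [inner_smul_right] at h
  have e1 : ∫ x in Ω, g x * (f x * d x) = ∫ x in Ω, f x * g x * d x := by
    congr 1; funext x; ring
  have e2 : ∫ x, v x * f x * g x ∂(surfaceMeasure Ω) =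
      ∫ x, v x * (f x * g x) ∂(surfaceMeasure Ω) := by
    congr 1; funext x; ring
  rw [e1, e2]
  linarith

/-- A function `u ∈ BV(Ω) ∩ L²(Ω)` with gradient measure `Du` and boundary trace `τ`, together with
a field `z` bounded by `1`, with divergence `d ∈ L²(Ω)` and normal trace `v`. The divergence enters
through the normal trace identity alone, which contains `div z = d` as its case of test functions
supported in `Ω`. -/
structure IsGreenPair (Ω : Opens (Euc N)) (z : Euc N → Euc N) (d v u : Euc N → ℝ)
    (Du : VectorMeasure (Euc N) (Euc N)) (τ : Euc N → ℝ) : Prop where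
  bv : IsBVWithGradient Ω u Du
  memLp : MemLp u 2 (volume.restrict Ω)
  trace : HasBoundaryTrace Ω u τ
  field : IsUnitBoundedField Ω z
  memLp_div : MemLp d 2 (volume.restrict Ω)
  normalTrace : HasNormalTrace Ω z d v
  abs_le_one : ∀ᵐ x ∂(surfaceMeasure Ω), |v x| ≤ 1

/-- The pairing `⟨(z, Du), χ⟩` extended to test functions `χ` that do not vanish on `∂Ω`, with the
boundary term which makes the result a measure carried by `Ω`. -/
noncomputable def extendedPairing (Ω : Opens (Euc N)) (z : Euc N → Euc N)
    (d v u τ χ : Euc N → ℝ) : ℝ :=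
  anzellottiPairing Ω z d u χ + ∫ x, v x * χ x * τ x ∂(surfaceMeasure Ω)

/-- The pairing is dominated by `|Du|` for test functions supported in a cone chart: it is the limit
of `∫_Ω χ z · ∇u_t`. -/
theorem IsConeChart.abs_extendedPairing_le (hN : 1 ≤ N)
    (hbdd : Bornology.IsBounded (Ω : Set (Euc N))) (ch : IsConeChart Ω x₀ e c r₀ t₀ A)
    (h : IsGreenPair Ω z d v u Du τ)
    {χ : Euc N → ℝ} (hχ : ContDiff ℝ ∞ χ) (hsub : tsupport χ ⊆ Metric.ball x₀ r₀) :
    |extendedPairing Ω z d v u τ χ| ≤ ∫ p, |χ p| ∂Du.variation := by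
  obtain ⟨hu, hu2, htr, hz, hd, hnt, hv⟩ := h
  have := hu.finite_variation
  have hΩm := Ω.isOpen.measurableSet
  have hΩfin : IsFiniteMeasure (volume.restrict (Ω : Set (Euc N))) :=
    ⟨by rw [Measure.restrict_apply_univ]; exact hbdd.measure_lt_top⟩
  have hcs : HasCompactSupport χ := Metric.isCompact_of_isClosed_isBounded (isClosed_tsupport _)
    (Metric.isBounded_ball.subset hsub)
  have hne : ((Ω : Set (Euc N))ᶜ).Nonempty := by
    rw [nonempty_compl]
    rintro h
    rw [h] at hbdd
    obtain ⟨n, rfl⟩ : ∃ n, N = n + 1 := ⟨N - 1, by omega⟩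
    exact NormedSpace.unbounded_univ ℝ (Euc (n + 1)) hbdd
  obtain ⟨B, hB⟩ := hχ.continuous.bounded_above_of_compact_support hcs
  obtain ⟨B', hB'⟩ := hχ.continuous_gradient.bounded_above_of_compact_support hcs.gradient
  obtain ⟨K, hK⟩ := exists_isMeanKernel e ch.c_pos
  set U := (Ω : Set (Euc N)).indicator u with hU
  have hU2 : MemLp U 2 := (memLp_indicator_iff_restrict hΩm).2 hu2
  set w := shiftedMean K U with hw
  have hwd : ∀ t, 0 < t → ContDiff ℝ ∞ (w t) := fun t ht =>
    hK.contDiff_shiftedMean hu.integrable_indicator ht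
  -- The normal trace identity expresses `R t` by integrals of `w t`, each of which converges as `t`
  -- tends to `0`: weakly in `L²(Ω)`, and in `L¹(∂Ω)` against the bounded function `v * χ`.
  set R : ℝ → ℝ := fun t => ∫ x in Ω, χ x * inner ℝ (z x) (gradient (w t) x) with hR
  have hident : ∀ t, 0 < t → R t = (∫ x, v x * χ x * w t x ∂(surfaceMeasure Ω)) -
      (∫ x in Ω, w t x * (χ x * d x)) - ∫ x in Ω, w t x * inner ℝ (z x) (gradient χ x) :=
    fun t ht => hnt.integral_mul_inner_gradient hz hχ hcs (hwd t ht)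
  have hL2 : ∀ g : Euc N → ℝ, MemLp g 2 (volume.restrict Ω) →
      Tendsto (fun t => ∫ x in Ω, w t x * g x) (𝓝[>] 0) (𝓝 (∫ x in Ω, u x * g x)) := by
    intro g hg
    have h := hK.tendsto_integral_shiftedMean_mul ch.c_le_one ch.norm_le_one hU2
      ((memLp_indicator_iff_restrict hΩm).2 hg)
    have e1 : ∀ f : Euc N → ℝ, ∫ x, f x * (Ω : Set (Euc N)).indicator g x =
        ∫ x in Ω, f x * g x := by
      intro f
      rw [← integral_indicator hΩm]
      congr 1; funext x
      by_cases hx : x ∈ (Ω : Set (Euc N)) <;> simp [hx]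
    simp_rw [e1] at h
    convert! h using 2
    refine setIntegral_congr_fun hΩm fun x hx => ?_
    simp only [hU, indicator_of_mem hx]
  have hl1 := hL2 (fun x => χ x * d x)
    (hd.mul (p := ⊤) (MemLp.of_bound hχ.continuous.aestronglyMeasurable B
      (Eventually.of_forall hB)))
  have hl2 := hL2 (fun x => inner ℝ (z x) (gradient χ x)) (by
    refine MemLp.of_bound (hz.1.inner hχ.continuous_gradient.aestronglyMeasurable) B' ?_
    filter_upwards [hz.2] with x hx
    exact (norm_inner_le_norm _ _).trans
      ((mul_le_of_le_one_left (norm_nonneg _) hx).trans (hB' x)))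
  have hl3 : Tendsto (fun t => ∫ x, v x * χ x * w t x ∂(surfaceMeasure Ω)) (𝓝[>] 0)
      (𝓝 (∫ x, v x * χ x * τ x ∂(surfaceMeasure Ω))) := by
    refine ch.tendsto_integral_mul_shiftedMean hN hne hK hu htr
      (hnt.1.1.mul hχ.continuous.aestronglyMeasurable) (B := B) ?_ ?_
    · filter_upwards [hv] with x hx
      rw [abs_mul]
      exact (mul_le_of_le_one_left (abs_nonneg _) hx).trans (hB x)
    · intro x hx
      rw [image_eq_zero_of_notMem_tsupport fun h => hx (hsub h), mul_zero]
  have hRlim : Tendsto R (𝓝[>] 0) (𝓝 (extendedPairing Ω z d v u τ χ)) := by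
    have h := (hl3.sub hl1).sub hl2
    have e1 : extendedPairing Ω z d v u τ χ = (∫ x, v x * χ x * τ x ∂(surfaceMeasure Ω)) -
        (∫ x in Ω, u x * (χ x * d x)) - ∫ x in Ω, u x * inner ℝ (z x) (gradient χ x) := by
      rw [extendedPairing, anzellottiPairing]
      simp_rw [mul_assoc]
      ring
    rw [e1]
    refine h.congr' ?_
    filter_upwards [self_mem_nhdsWithin] with t ht
    exact (hident t ht).symm
  have hχint : Integrable (fun p => |χ p|) Du.variation :=
    (Integrable.of_bound hχ.continuous.aestronglyMeasurable B (Eventually.of_forall hB)).abs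
  -- For small `t` the oscillation of `χ` at scale `2 * t` is at most `ε`, which costs `ε * m ≤ δ`.
  refine le_of_forall_pos_le_add fun δ hδ => ?_
  set m : ℝ := Du.variation.real univ with hm
  have hm0 : 0 ≤ m := measureReal_nonneg
  set ε : ℝ := δ / (m + 1) with hε
  have hε0 : 0 < ε := by positivity
  have huc : UniformContinuous χ := by
    obtain ⟨C, hC⟩ := (hχ.of_le (by simp : (1 : WithTop ℕ∞) ≤ ∞)).lipschitzWith_of_hasCompactSupport
      hcs one_ne_zero
    exact hC.uniformContinuous
  obtain ⟨ρ, hρ, hρε⟩ := Metric.uniformContinuous_iff.1 huc ε hε0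
  refine le_of_tendsto hRlim.abs ?_
  filter_upwards [self_mem_nhdsWithin, nhdsWithin_le_nhds (Iio_mem_nhds ch.t_pos),
    nhdsWithin_le_nhds (Iio_mem_nhds (half_pos hρ))] with t ht ht0 htρ
  have h1 := ch.enorm_integral_mul_inner_gradient_le hK hu hz hχ.continuous hsub ht ht0
    (ε := ε) fun x p hxp => by
      have htρ' : t < ρ / 2 := htρ
      have h2 : dist (χ x) (χ p) < ε := hρε (by rw [dist_comm, dist_eq_norm]; linarith)
      rw [Real.dist_eq] at h2
      have := abs_sub_abs_le_abs_sub (χ x) (χ p)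
      linarith
  have hχε : Integrable (fun p => |χ p| + ε) Du.variation := hχint.add (integrable_const ε)
  rw [← ofReal_integral_eq_lintegral_ofReal hχε
    (Eventually.of_forall fun p => by positivity), ← ofReal_norm,
    ENNReal.ofReal_le_ofReal_iff (integral_nonneg fun p => by positivity)] at h1
  refine h1.trans ?_
  rw [integral_add hχint (integrable_const ε), integral_const, smul_eq_mul]
  gcongr
  rw [hε, ← hm, mul_div_assoc', div_le_iff₀ (by positivity)]
  nlinarith
end

/-! ### The global Green formula and monotonicity -/

section
variable {N : ℕ} {Ω : Opens (Euc N)} {u τ d v : Euc N → ℝ}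
  {z : Euc N → Euc N} {Du : VectorMeasure (Euc N) (Euc N)}

theorem extendedPairing_congr {f g : Euc N → ℝ} (h : EqOn f g (closure (Ω : Set (Euc N)))) :
    extendedPairing Ω z d v u τ f = extendedPairing Ω z d v u τ g := by
  have hΩm := Ω.isOpen.measurableSet
  have hfg : ∀ x ∈ (Ω : Set (Euc N)), f x = g x := fun x hx => h (subset_closure hx)
  have hgrad : ∀ x ∈ (Ω : Set (Euc N)), gradient f x = gradient g x := fun x hx =>
    Filter.EventuallyEq.gradient_eq (Filter.eventuallyEq_of_mem (Ω.isOpen.mem_nhds hx) hfg)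
  unfold extendedPairing anzellottiPairing
  congr 1
  · congr 1
    · rw [neg_inj]
      exact setIntegral_congr_fun hΩm fun x hx => by simp only [hfg x hx]
    · exact setIntegral_congr_fun hΩm fun x hx => by simp only [hgrad x hx]
  · refine integral_congr_ae ?_
    filter_upwards [ae_surfaceMeasure_mem_frontier Ω] with x hx
    rw [h hx.1]

theorem IsGreenPair.extendedPairing_add (h : IsGreenPair Ω z d v u Du τ) {f g : Euc N → ℝ}
    (hf : ContDiff ℝ ∞ f) (hfs : HasCompactSupport f) (hg : ContDiff ℝ ∞ g)
    (hgs : HasCompactSupport g) :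
    extendedPairing Ω z d v u τ (fun x => f x + g x) =
      extendedPairing Ω z d v u τ f + extendedPairing Ω z d v u τ g := by
  have h1 : ∀ f : Euc N → ℝ, ContDiff ℝ ∞ f → HasCompactSupport f →
      Integrable (fun x => u x * f x * d x) (volume.restrict Ω) := by
    intro f hf hfs
    obtain ⟨B, hB⟩ := hf.continuous.bounded_above_of_compact_support hfs
    refine ((h.memLp.integrable_mul h.memLp_div).mul_bdd hf.continuous.aestronglyMeasurable
      (Eventually.of_forall hB)).congr (Eventually.of_forall fun x => ?_)
    simp only [Pi.mul_apply]
    ring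
  have h2 : ∀ f : Euc N → ℝ, ContDiff ℝ ∞ f → HasCompactSupport f →
      Integrable (fun x => u x * inner ℝ (z x) (gradient f x)) (volume.restrict Ω) := by
    intro f hf hfs
    obtain ⟨B, hB⟩ := hf.continuous_gradient.bounded_above_of_compact_support hfs.gradient
    refine h.bv.integrableOn.integrable.mul_bdd
      (h.field.1.inner hf.continuous_gradient.aestronglyMeasurable) (c := B) ?_
    filter_upwards [h.field.2] with x hx
    exact (norm_inner_le_norm _ _).trans
      ((mul_le_of_le_one_left (norm_nonneg _) hx).trans (hB x))
  have h3 : ∀ f : Euc N → ℝ, ContDiff ℝ ∞ f → HasCompactSupport f →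
      Integrable (fun x => v x * f x * τ x) (surfaceMeasure Ω) := by
    intro f hf hfs
    obtain ⟨B, hB⟩ := hf.continuous.bounded_above_of_compact_support hfs
    refine h.trace.1.bdd_mul (h.normalTrace.1.1.mul hf.continuous.aestronglyMeasurable)
      (c := B) ?_
    filter_upwards [h.abs_le_one] with x hx
    rw [norm_mul]
    exact (mul_le_of_le_one_left (norm_nonneg _) hx).trans (hB x)
  have hgrad : ∀ x, gradient (fun x => f x + g x) x = gradient f x + gradient g x := fun x => by
    have h := ((hf.differentiable (by simp) x).hasFDerivAt.add
      (hg.differentiable (by simp) x).hasFDerivAt).fderiv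
    unfold gradient
    erw [h]
    simp
  unfold extendedPairing anzellottiPairing
  simp_rw [hgrad, inner_add_right, mul_add, add_mul]
  rw [integral_add (h1 f hf hfs) (h1 g hg hgs), integral_add (h2 f hf hfs) (h2 g hg hgs),
    integral_add (h3 f hf hfs) (h3 g hg hgs)]
  ring

theorem IsGreenPair.extendedPairing_sum (h : IsGreenPair Ω z d v u Du τ) {ι : Type*}
    (s : Finset ι) {f : ι → Euc N → ℝ} (hf : ∀ i, ContDiff ℝ ∞ (f i))
    (hfs : ∀ i, HasCompactSupport (f i)) :
    extendedPairing Ω z d v u τ (fun x => ∑ i ∈ s, f i x) =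
      ∑ i ∈ s, extendedPairing Ω z d v u τ (f i) := by
  classical
  induction s using Finset.induction_on with
  | empty =>
    have : gradient (fun _ : Euc N => (0 : ℝ)) = 0 := funext fun x => gradient_fun_const x 0
    simp [extendedPairing, anzellottiPairing, this]
  | insert a s ha ih =>
    simp_rw [Finset.sum_insert ha]
    rw [← ih]
    refine h.extendedPairing_add (hf a) (hfs a) (ContDiff.sum fun i _ => hf i) ?_
    clear ih ha
    induction s using Finset.induction_on with
    | empty => exact HasCompactSupport.zero
    | insert b s hb ih =>
      simp_rw [Finset.sum_insert hb]
      exact (hfs b).add ih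

/-- The pairing is dominated by `|Du|`, without boundary contribution. -/
theorem IsGreenPair.abs_extendedPairing_le (hN : 1 ≤ N)
    (hbdd : Bornology.IsBounded (Ω : Set (Euc N))) (hΩ : HasSmoothBoundary Ω)
    (h : IsGreenPair Ω z d v u Du τ) {χ : Euc N → ℝ} (hχ : ContDiff ℝ ∞ χ)
    (hχs : HasCompactSupport χ) :
    |extendedPairing Ω z d v u τ χ| ≤ ∫ p, |χ p| ∂Du.variation := by
  have := h.bv.finite_variation
  have hchart : ∀ x ∈ closure (Ω : Set (Euc N)), ∃ r, 0 < r ∧ ∃ e c t₀ A,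
      IsConeChart Ω x e c r t₀ A := by
    intro x hx
    by_cases hxΩ : x ∈ Ω
    · obtain ⟨e, c, r, t₀, A, ch⟩ := exists_isConeChart_of_mem hxΩ
      exact ⟨r, ch.r_pos, e, c, t₀, A, ch⟩
    · obtain ⟨e, c, r, t₀, A, ch⟩ := hΩ.exists_isConeChart (x₀ := x) (by
        rw [Ω.isOpen.frontier_eq]
        exact ⟨hx, hxΩ⟩)
      exact ⟨r, ch.r_pos, e, c, t₀, A, ch⟩
  choose! r hr e c t₀ A ch using hchart
  obtain ⟨s, hs, hcover⟩ := hbdd.isCompact_closure.elim_nhds_subcover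
    (fun x => Metric.ball x (r x)) fun x hx => Metric.ball_mem_nhds x (hr x hx)
  obtain ⟨f, hf⟩ := SmoothPartitionOfUnity.exists_isSubordinate (ι := s) 𝓘(ℝ, Euc N)
    (isClosed_closure (s := (Ω : Set (Euc N)))) (fun i => Metric.ball (i : Euc N) (r i))
    (fun i => Metric.isOpen_ball) (by simpa [iUnion_subtype] using hcover)
  have hfsm : ∀ i, ContDiff ℝ ∞ (f i) := fun i => (f i).contMDiff.contDiff
  have hfsum : ∀ x, ∑ᶠ i, f i x = ∑ i, f i x := fun x => finsum_eq_sum_of_fintype _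
  have hterm : ∀ i, |extendedPairing Ω z d v u τ (fun x => χ x * f i x)| ≤
      ∫ p, |χ p * f i p| ∂Du.variation := fun i =>
    (ch i (hs i i.2)).abs_extendedPairing_le hN hbdd h (hχ.mul (hfsm i))
      ((tsupport_mul_subset_right).trans (hf i))
  have hsum : extendedPairing Ω z d v u τ χ =
      ∑ i, extendedPairing Ω z d v u τ (fun x => χ x * f i x) := by
    rw [← h.extendedPairing_sum Finset.univ (fun i => hχ.mul (hfsm i)) fun i => hχs.mul_right]
    refine extendedPairing_congr fun x hx => ?_
    rw [← Finset.mul_sum, ← hfsum, f.sum_eq_one hx, mul_one]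
  have hint : ∀ g : Euc N → ℝ, Continuous g → HasCompactSupport g →
      Integrable (fun p => |g p|) Du.variation := fun g hg hgs => by
    obtain ⟨B, hB⟩ := hg.bounded_above_of_compact_support hgs
    exact (Integrable.of_bound hg.aestronglyMeasurable B (Eventually.of_forall hB)).abs
  rw [hsum]
  calc _ ≤ ∑ i, ∫ p, |χ p * f i p| ∂Du.variation :=
        (Finset.abs_sum_le_sum_abs _ _).trans (Finset.sum_le_sum fun i _ => hterm i)
    _ = ∫ p, ∑ i, |χ p * f i p| ∂Du.variation :=
        (integral_finsetSum _ fun i _ => hint _ (hχ.continuous.mul (hfsm i).continuous)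
          hχs.mul_right).symm
    _ ≤ ∫ p, |χ p| ∂Du.variation := by
        refine integral_mono (integrable_finsetSum _ fun i _ =>
          hint _ (hχ.continuous.mul (hfsm i).continuous) hχs.mul_right)
          (hint χ hχ.continuous hχs) fun p => ?_
        simp_rw [abs_mul, fun i => abs_of_nonneg (f.nonneg i p)]
        rw [← Finset.mul_sum, ← hfsum]
        exact mul_le_of_le_one_right (abs_nonneg _) (f.sum_le_one p)

theorem exists_testFunction_eq_one {V : Opens (Euc N)} {S : Set (Euc N)} (hS : IsCompact S)
    (hSV : S ⊆ V) : ∃ φ : 𝓓(V, ℝ), (∀ x ∈ S, φ x = 1) ∧ ∀ x, φ x ∈ Icc (0 : ℝ) 1 := by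
  obtain ⟨W, hWo, hSW, hWV, hWc⟩ := exists_open_between_and_isCompact_closure hS V.isOpen hSV
  obtain ⟨f, hf, hrange, hsupp, hone⟩ := exists_contMDiff_support_eq_eq_one_iff
    (n := ⊤) 𝓘(ℝ, Euc N) hWo hS.isClosed hSW
  have htsupp : tsupport f = closure W := by rw [tsupport, hsupp]
  obtain ⟨φ, hφ⟩ := exists_testFunction_eq (Ω := V) hf.contDiff
    (by rw [HasCompactSupport, htsupp]; exact hWc) (by rw [htsupp]; exact hWV)
  rw [← hφ] at hone hrange
  exact ⟨φ, fun x hx => (hone x).1 hx, fun x => hrange ⟨x, rfl⟩⟩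

theorem extendedPairing_of_eqOn_one {ψ : Euc N → ℝ} (hψ : EqOn ψ 1 (closure (Ω : Set (Euc N)))) :
    extendedPairing Ω z d v u τ ψ =
      (∫ x, v x * τ x ∂(surfaceMeasure Ω)) - ∫ x in Ω, u x * d x := by
  rw [extendedPairing_congr hψ]
  have : gradient (1 : Euc N → ℝ) = 0 := funext fun x => gradient_const x 1
  simp [extendedPairing, anzellottiPairing, this]
  ring

theorem IsGreenPair.integral_sub_integral_le (hN : 1 ≤ N)
    (hbdd : Bornology.IsBounded (Ω : Set (Euc N))) (hΩ : HasSmoothBoundary Ω)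
    (h : IsGreenPair Ω z d v u Du τ) :
    (∫ x, v x * τ x ∂(surfaceMeasure Ω)) - ∫ x in Ω, u x * d x ≤ Du.variation.real univ := by
  have := h.bv.finite_variation
  obtain ⟨ψ, hψ1, hψ⟩ := exists_testFunction_eq_one (V := ⊤) hbdd.isCompact_closure (subset_univ _)
  rw [← extendedPairing_of_eqOn_one (z := z) hψ1]
  refine (le_abs_self _).trans ((h.abs_extendedPairing_le hN hbdd hΩ ψ.contDiff
    ψ.hasCompactSupport).trans ?_)
  have : ∫ p, |ψ p| ∂Du.variation ≤ ∫ p, 1 ∂Du.variation := by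
    refine integral_mono_of_nonneg (Eventually.of_forall fun p => abs_nonneg _)
      (integrable_const 1) (Eventually.of_forall fun p => ?_)
    simp only [abs_of_nonneg (hψ p).1, (hψ p).2]
  simpa using this

/-- When `(z, Du) = |Du|` in `Ω`, the Green formula attains the total variation: up to a small mass
of `|Du|`, the constant `1` is a test function supported in `Ω`. -/
theorem IsGreenPair.variation_le_integral_sub_integral (hN : 1 ≤ N)
    (hbdd : Bornology.IsBounded (Ω : Set (Euc N))) (hΩ : HasSmoothBoundary Ω)
    (h : IsGreenPair Ω z d v u Du τ)
    (hpair : ∀ φ : 𝓓(Ω, ℝ), anzellottiPairing Ω z d u φ = ∫ x, φ x ∂Du.variation) :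
    Du.variation.real univ ≤ (∫ x, v x * τ x ∂(surfaceMeasure Ω)) - ∫ x in Ω, u x * d x := by
  have := h.bv.finite_variation
  obtain ⟨ψ, hψ1, hψ⟩ := exists_testFunction_eq_one (V := ⊤) hbdd.isCompact_closure (subset_univ _)
  rw [← extendedPairing_of_eqOn_one (z := z) hψ1]
  refine le_of_forall_pos_le_add fun ε hε => ?_
  obtain ⟨S, hSΩ, hS, hSε⟩ := Ω.isOpen.measurableSet.exists_isCompact_sdiff_lt
    (measure_ne_top Du.variation _) (ENNReal.ofReal_pos.2 (half_pos hε)).ne'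
  obtain ⟨φ, hφ1, hφ⟩ := exists_testFunction_eq_one (V := Ω) hS hSΩ
  have hφ0 : ∀ x ∉ Ω, φ x = 0 := fun x hx =>
    image_eq_zero_of_notMem_tsupport fun hx' => hx (φ.tsupport_subset hx')
  -- `φ` vanishes on `∂Ω`, so its extended pairing is the pairing in `Ω`.
  have hφext : extendedPairing Ω z d v u τ φ = ∫ x, φ x ∂Du.variation := by
    rw [← hpair, extendedPairing]
    have : ∫ x, v x * φ x * τ x ∂(surfaceMeasure Ω) = ∫ x, 0 ∂(surfaceMeasure Ω) := by
      refine integral_congr_ae ?_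
      filter_upwards [ae_surfaceMeasure_mem_frontier Ω] with x hx
      rw [Ω.isOpen.frontier_eq] at hx
      rw [hφ0 x hx.2]
      ring
    rw [this]
    simp
  have hsplit : extendedPairing Ω z d v u τ ψ = extendedPairing Ω z d v u τ φ +
      extendedPairing Ω z d v u τ (fun x => ψ x - φ x) := by
    rw [← h.extendedPairing_add φ.contDiff φ.hasCompactSupport (ψ.contDiff.sub φ.contDiff)
      (ψ.hasCompactSupport.sub φ.hasCompactSupport)]
    congr 1
    funext x
    ring
  -- The remaining part `ψ - φ` vanishes on `S`, so the pairing with it is at most `ε / 2`, the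
  -- bound for the mass of `|Du|` outside `S`.
  have hrest := h.abs_extendedPairing_le hN hbdd hΩ (ψ.contDiff.sub φ.contDiff)
      (ψ.hasCompactSupport.sub φ.hasCompactSupport)
  have hae : ∀ᵐ p ∂Du.variation, p ∈ (Ω : Set (Euc N)) := by
    rw [ae_iff]; exact h.bv.variation_compl
  have hφint : Integrable φ Du.variation := Integrable.of_bound
    φ.continuous.aestronglyMeasurable 1 (Eventually.of_forall fun x => by
      rw [Real.norm_of_nonneg (hφ x).1]; exact (hφ x).2)
  have hrest' : ∫ p, |ψ p - φ p| ∂Du.variation =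
      Du.variation.real univ - ∫ p, φ p ∂Du.variation := by
    have h1 : ∫ p, |ψ p - φ p| ∂Du.variation = ∫ p, (1 - φ p) ∂Du.variation := by
      refine integral_congr_ae ?_
      filter_upwards [hae] with p hp
      rw [hψ1 p (subset_closure hp), abs_of_nonneg]
      linarith [(hφ p).2]
    rw [h1, integral_sub (integrable_const _) hφint]
    simp
  have hφS : Du.variation.real univ - ε / 2 ≤ ∫ p, φ p ∂Du.variation := by
    have h1 : Du.variation.real S ≤ ∫ p, φ p ∂Du.variation := by
      rw [← integral_indicator_one hS.measurableSet]
      refine integral_mono ((integrable_const 1).indicator hS.measurableSet) hφint fun p => ?_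
      by_cases hp : p ∈ S
      · rw [indicator_of_mem hp, hφ1 p hp]; exact le_rfl
      · rw [indicator_of_notMem hp]; exact (hφ p).1
    have h2 : Du.variation.real ((Ω : Set (Euc N)) \ S) ≤ ε / 2 :=
      ENNReal.toReal_le_of_le_ofReal (by positivity) hSε.le
    have h3 : Du.variation.real univ = Du.variation.real Ω :=
      measureReal_congr (eventuallyEq_univ.2 hae).symm
    have h4 := measureReal_union_le (μ := Du.variation) S ((Ω : Set (Euc N)) \ S)
    rw [union_sdiff_cancel hSΩ] at h4
    linarith
  have := (abs_le.1 hrest).1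
  linarith

theorem mul_nonneg_of_mem_multiSign {s₁ s₂ t₁ t₂ : ℝ} (h₁ : t₁ ∈ multiSign s₁)
    (h₂ : t₂ ∈ multiSign s₂) : 0 ≤ (t₁ - t₂) * (s₁ - s₂) := by
  have hb : ∀ {s t : ℝ}, t ∈ multiSign s → -1 ≤ t ∧ t ≤ 1 ∧ t * s = |s| := by
    rintro s t ⟨hp, hn, hz⟩
    rcases lt_trichotomy s 0 with hs | hs | hs
    · rw [hn hs, abs_of_neg hs]; norm_num
    · have := hz hs
      subst hs
      simpa using this
    · rw [hp hs, abs_of_pos hs]; norm_num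
  obtain ⟨a1, b1, c1⟩ := hb h₁
  obtain ⟨a2, b2, c2⟩ := hb h₂
  have h12 : t₁ * s₂ ≤ |s₂| := by
    refine (le_abs_self _).trans ?_
    rw [abs_mul]
    exact mul_le_of_le_one_left (abs_nonneg _) (abs_le.2 ⟨a1, b1⟩)
  have h21 : t₂ * s₁ ≤ |s₁| := by
    refine (le_abs_self _).trans ?_
    rw [abs_mul]
    exact mul_le_of_le_one_left (abs_nonneg _) (abs_le.2 ⟨a2, b2⟩)
  linarith

theorem norm_le_norm_add_smul_of_inner_nonneg {X : Type*} [NormedAddCommGroup X]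
    [InnerProductSpace ℝ X] {a b : X} (h : 0 ≤ inner ℝ a b) {α : ℝ} (hα : 0 ≤ α) :
    ‖a‖ ≤ ‖a + α • b‖ := by
  refine le_of_sq_le_sq ?_ (norm_nonneg _)
  rw [norm_add_sq_real, inner_smul_right]
  nlinarith [mul_nonneg hα h, sq_nonneg ‖α • b‖]

/-- The trace parts contribute `lam ∫_Ω (u₁ - u₂)²` or more, by Green's formula, and the remaining
parts are nonnegative pointwise. -/
theorem boundaryOperator_monotone (hN : 1 ≤ N)
    (hbdd : Bornology.IsBounded (Ω : Set (Euc N))) (hΩ : HasSmoothBoundary Ω) {lam : ℝ}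
    (hlam : 0 < lam) {ω₁ ω₂ v₁ v₂ : L2Boundary Ω} (h₁ : v₁ ∈ boundaryOperator lam Ω ω₁)
    (h₂ : v₂ ∈ boundaryOperator lam Ω ω₂) :
    0 ≤ ∫ x, (v₁ x - v₂ x) * (ω₁ x - ω₂ x) ∂(surfaceMeasure Ω) := by
  obtain ⟨hv₁, u₁, Du₁, τ₁, z₁, hbv₁, hL₁, htr₁, hz₁, -, hpair₁, hnt₁, hs₁⟩ := h₁
  obtain ⟨hv₂, u₂, Du₂, τ₂, z₂, hbv₂, hL₂, htr₂, hz₂, -, hpair₂, hnt₂, hs₂⟩ := h₂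
  have g₁₁ : IsGreenPair Ω z₁ (fun x => lam * u₁ x) v₁ u₁ Du₁ τ₁ :=
    ⟨hbv₁, hL₁, htr₁, hz₁, hL₁.const_mul lam, hnt₁, hv₁⟩
  have g₁₂ : IsGreenPair Ω z₁ (fun x => lam * u₁ x) v₁ u₂ Du₂ τ₂ :=
    ⟨hbv₂, hL₂, htr₂, hz₁, hL₁.const_mul lam, hnt₁, hv₁⟩
  have g₂₁ : IsGreenPair Ω z₂ (fun x => lam * u₂ x) v₂ u₁ Du₁ τ₁ :=
    ⟨hbv₁, hL₁, htr₁, hz₂, hL₂.const_mul lam, hnt₂, hv₂⟩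
  have g₂₂ : IsGreenPair Ω z₂ (fun x => lam * u₂ x) v₂ u₂ Du₂ τ₂ :=
    ⟨hbv₂, hL₂, htr₂, hz₂, hL₂.const_mul lam, hnt₂, hv₂⟩
  -- The two total variations are upper bounds for the crossed pairs and lower bounds for the given
  -- pairs, so they cancel when the four inequalities are added.
  have i₁₁ := g₁₁.variation_le_integral_sub_integral hN hbdd hΩ hpair₁
  have i₂₂ := g₂₂.variation_le_integral_sub_integral hN hbdd hΩ hpair₂
  have i₁₂ := g₁₂.integral_sub_integral_le hN hbdd hΩ
  have i₂₁ := g₂₁.integral_sub_integral_le hN hbdd hΩ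
  have hvτ : ∀ {v : L2Boundary Ω} {τ : Euc N → ℝ}, (∀ᵐ x ∂(surfaceMeasure Ω), |v x| ≤ 1) →
      HasBoundaryTrace Ω u₁ τ ∨ HasBoundaryTrace Ω u₂ τ →
      Integrable (fun x => v x * τ x) (surfaceMeasure Ω) := by
    intro v τ hv hτ
    have hτi : Integrable τ (surfaceMeasure Ω) := hτ.elim (·.1) (·.1)
    exact hτi.bdd_mul (Lp.aestronglyMeasurable v) hv
  have k₁₁ := hvτ hv₁ (Or.inl htr₁)
  have k₁₂ := hvτ hv₁ (Or.inr htr₂)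
  have k₂₁ := hvτ hv₂ (Or.inl htr₁)
  have k₂₂ := hvτ hv₂ (Or.inr htr₂)
  have henergy : 0 ≤ (∫ x in Ω, u₁ x * (lam * u₁ x)) + (∫ x in Ω, u₂ x * (lam * u₂ x)) -
      (∫ x in Ω, u₂ x * (lam * u₁ x)) - ∫ x in Ω, u₁ x * (lam * u₂ x) := by
    have m₁₁ := hL₁.integrable_mul (hL₁.const_mul lam)
    have m₂₂ := hL₂.integrable_mul (hL₂.const_mul lam)
    have m₂₁ := hL₂.integrable_mul (hL₁.const_mul lam)
    have m₁₂ := hL₁.integrable_mul (hL₂.const_mul lam)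
    have e : (∫ x in Ω, u₁ x * (lam * u₁ x)) + (∫ x in Ω, u₂ x * (lam * u₂ x)) -
        (∫ x in Ω, u₂ x * (lam * u₁ x)) - ∫ x in Ω, u₁ x * (lam * u₂ x) =
        ∫ x in Ω, lam * (u₁ x - u₂ x) ^ 2 := by
      have a₁ := integral_add m₁₁ m₂₂
      have a₂ := integral_sub (m₁₁.add m₂₂) m₂₁
      have a₃ := integral_sub ((m₁₁.add m₂₂).sub m₂₁) m₁₂
      simp only [Pi.mul_apply, Pi.add_apply, Pi.sub_apply] at a₁ a₂ a₃
      rw [← a₁, ← a₂, ← a₃]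
      congr 1; funext x; ring
    rw [e]
    exact integral_nonneg fun x => by positivity
  have hτsum : (∫ x, (v₁ x - v₂ x) * (τ₁ x - τ₂ x) ∂(surfaceMeasure Ω)) =
      (∫ x, v₁ x * τ₁ x ∂(surfaceMeasure Ω)) + (∫ x, v₂ x * τ₂ x ∂(surfaceMeasure Ω)) -
      (∫ x, v₁ x * τ₂ x ∂(surfaceMeasure Ω)) - ∫ x, v₂ x * τ₁ x ∂(surfaceMeasure Ω) := by
    have a₁ := integral_add k₁₁ k₂₂
    have a₂ := integral_sub (k₁₁.add k₂₂) k₁₂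
    have a₃ := integral_sub ((k₁₁.add k₂₂).sub k₁₂) k₂₁
    simp only [Pi.add_apply, Pi.sub_apply] at a₁ a₂ a₃
    rw [← a₁, ← a₂, ← a₃]
    congr 1; funext x; ring
  have hτint : Integrable (fun x => (v₁ x - v₂ x) * (τ₁ x - τ₂ x)) (surfaceMeasure Ω) :=
    (((k₁₁.add k₂₂).sub k₁₂).sub k₂₁).congr (Eventually.of_forall fun x => by
      simp only [Pi.add_apply, Pi.sub_apply]; ring)
  have hωint : Integrable (fun x => (v₁ x - v₂ x) * (ω₁ x - ω₂ x)) (surfaceMeasure Ω) :=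
    ((Lp.memLp v₁).sub (Lp.memLp v₂)).integrable_mul ((Lp.memLp ω₁).sub (Lp.memLp ω₂))
  have hmono : (∫ x, (v₁ x - v₂ x) * (τ₁ x - τ₂ x) ∂(surfaceMeasure Ω)) ≤
      ∫ x, (v₁ x - v₂ x) * (ω₁ x - ω₂ x) ∂(surfaceMeasure Ω) := by
    refine integral_mono_ae hτint hωint ?_
    filter_upwards [hs₁, hs₂] with x hx₁ hx₂
    have := mul_nonneg_of_mem_multiSign hx₁ hx₂
    nlinarith
  linarith

theorem inner_sub_sub_nonneg_of_integral {ω₁ ω₂ v₁ v₂ : L2Boundary Ω}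
    (h : 0 ≤ ∫ x, (v₁ x - v₂ x) * (ω₁ x - ω₂ x) ∂(surfaceMeasure Ω)) :
    0 ≤ (inner ℝ (v₁ - v₂) (ω₁ - ω₂) : ℝ) := by
  rw [L2.inner_def]
  refine h.trans (le_of_eq (integral_congr_ae ?_))
  filter_upwards [Lp.coeFn_sub v₁ v₂, Lp.coeFn_sub ω₁ ω₂] with x h1 h2
  rw [h1, h2]
  simp [mul_comm]
end

end

theorem mainTheorem4 (N : ℕ) (hN : 1 ≤ N) (Ω : TopologicalSpace.Opens (Euc N))
    (hbdd : Bornology.IsBounded (Ω : Set (Euc N))) (hsmooth : HasSmoothBoundary Ω)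
    (lam : ℝ) (hlam : 0 < lam) :
    (∀ ω₁ ω₂ v₁ v₂ : L2Boundary Ω,
      v₁ ∈ boundaryOperator lam Ω ω₁ → v₂ ∈ boundaryOperator lam Ω ω₂ →
        0 ≤ ∫ x, (v₁ x - v₂ x) * (ω₁ x - ω₂ x) ∂(surfaceMeasure Ω)) ∧
    IsAccretive (boundaryOperator lam Ω) ∧
    IsResolventAccretive (boundaryOperator lam Ω) := by
  have hmono : ∀ ω₁ ω₂ v₁ v₂ : L2Boundary Ω,
      v₁ ∈ boundaryOperator lam Ω ω₁ → v₂ ∈ boundaryOperator lam Ω ω₂ →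
        0 ≤ ∫ x, (v₁ x - v₂ x) * (ω₁ x - ω₂ x) ∂(surfaceMeasure Ω) :=
    fun _ _ _ _ h₁ h₂ => boundaryOperator_monotone hN hbdd hsmooth hlam h₁ h₂
  refine ⟨hmono, fun w w' v v' h h' α hα => ?_, fun w w' v v' h h' α hα => ?_⟩
  · exact norm_le_norm_add_smul_of_inner_nonneg
      (inner_sub_sub_nonneg_of_integral (hmono w w' v v' h h')) hα
  · refine norm_le_norm_add_smul_of_inner_nonneg ?_ hα
    rw [real_inner_comm]
    exact inner_sub_sub_nonneg_of_integral (hmono w w' v v' h h')
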